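/- Let $n\ge 1$ and let $D\subset\mathbb R^n$ be a bounded nonempty open set (for instance a bounded domain). All functions $u$ are complex valued and $\|\cdot\|_p$ is the norm of $L^p(D)$. Let $W_0^{1,2}(D)$ be the closure of $C_0^\infty(D)$ with respect to $\|\nabla u\|_2$ (equivalently, since $D$ is bounded, in $W^{1,2}(D)$). Let $1\le r\le\infty$ with $r>n/2$, let $q=r^*$ be the Hölder conjugate exponent, $\frac1q+\frac1r=1$ (with $1^*=\infty$, $\infty^*=1$), and put $$K_q(D)=\sup_{0\ne u\in W_0^{1,2}(D)}\frac{\|u\|_{2q}}{\|\nabla u\|_2}.$$ For a real-valued measurable function $V$ on $D$, a function $u\in W_0^{1,2}(D)$ is a solution of $$-\Delta u=Vu\quad\text{in }D \tag{1}$$ if, for every $\psi\in C_0^\infty(D)$, $Vu\psi$ is integrable on $D$ and $\int_D\nabla u\cdot\nabla\psi\,dx=\int_D Vu\psi\,dx$; it is nontrivial if it is not zero a.e. on $D$. Write $V_+=\max\{V,0\}$. Then $K_q(D)<\infty$, and: (a) If (1) has a nontrivial solution $u\in W_0^{1,2}(D)$ for some real-valued $V\in L^r(D)$, then $$K_q(D)^2\,\|V_+\|_r\ge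 1. \tag{2}$$ (b) Suppose in addition that $r>1$ (automatic if $n\ge2$), so that $q<\infty$. Then there is an extremal, that is, a nontrivial $u_*\in W_0^{1,2}(D)$ with $\|u_*\|_{2q}=K_q(D)\|\nabla u_*\|_2$. For every extremal $u_*$, the function $$V(x)=\frac{\|\nabla u_*\|_2^2}{\|u_*\|_{2q}^{2q}}\,|u_*(x)|^{2q-2}$$ belongs to $L^r(D)$, $u_*$ is a solution of (1) with this $V$, and equality holds in (2). (For $q=1$, $|u_*|^{2q-2}$ is read as $1$.) -/

import Mathlib

open MeasureTheory Filter Topology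
open scoped ENNReal ContDiff

noncomputable section

/-- A complex-valued test function on `D`: an element of `C_0^∞(D)`. -/
structure IsTestFunction {n : ℕ} (D : Set (EuclideanSpace ℝ (Fin n)))
    (φ : EuclideanSpace ℝ (Fin n) → ℂ) : Prop where
  contDiff : ContDiff ℝ ∞ φ
  hasCompactSupport : HasCompactSupport φ
  tsupport_subset : tsupport φ ⊆ D

/-- The classical gradient `(∂₁φ, …, ∂ₙφ)` of a complex-valued function. -/
def classicalGrad {n : ℕ} (φ : EuclideanSpace ℝ (Fin n) → ℂ) (x : EuclideanSpace ℝ (Fin n)) :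
    EuclideanSpace ℂ (Fin n) :=
  WithLp.toLp 2 fun i => fderiv ℝ φ x (EuclideanSpace.single i 1)

/-- `g` is a weak gradient of `u` on `D`: `∫_D u ∂ᵢφ = - ∫_D gᵢ φ` for all test functions. It is
used only for `u` and `g` in `L²(D)`, so that the integrals converge. -/
def IsWeakGradient {n : ℕ} (D : Set (EuclideanSpace ℝ (Fin n)))
    (u : EuclideanSpace ℝ (Fin n) → ℂ)
    (g : EuclideanSpace ℝ (Fin n) → EuclideanSpace ℂ (Fin n)) : Prop :=
  ∀ φ : EuclideanSpace ℝ (Fin n) → ℂ, IsTestFunction D φ → ∀ i : Fin n,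
    ∫ x in D, u x * classicalGrad φ x i = - ∫ x in D, g x i * φ x

/-- `u ∈ W^{1,2}(D)`: `u ∈ L²(D)` with a weak gradient in `L²(D)`. -/
def MemW12 {n : ℕ} (D : Set (EuclideanSpace ℝ (Fin n)))
    (u : EuclideanSpace ℝ (Fin n) → ℂ) : Prop :=
  MemLp u 2 (volume.restrict D) ∧
    ∃ g : EuclideanSpace ℝ (Fin n) → EuclideanSpace ℂ (Fin n),
      MemLp g 2 (volume.restrict D) ∧ IsWeakGradient D u g

open Classical in
/-- The weak gradient `∇u` of `u ∈ W^{1,2}(D)` (unique a.e. on the open set `D`); it is `0` by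
convention if `u ∉ W^{1,2}(D)`. -/
def weakGrad {n : ℕ} (D : Set (EuclideanSpace ℝ (Fin n)))
    (u : EuclideanSpace ℝ (Fin n) → ℂ) :
    EuclideanSpace ℝ (Fin n) → EuclideanSpace ℂ (Fin n) :=
  if h : MemW12 D u then h.2.choose else 0

/-- `u ∈ W₀^{1,2}(D)`: `u` is the limit of test functions in the norm of `W^{1,2}(D)`. For bounded
`D` this norm is equivalent to `‖∇u‖₂` on test functions, by Poincaré's inequality. -/
def MemW012 {n : ℕ} (D : Set (EuclideanSpace ℝ (Fin n)))
    (u : EuclideanSpace ℝ (Fin n) → ℂ) : Prop :=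
  MemW12 D u ∧ ∃ φ : ℕ → EuclideanSpace ℝ (Fin n) → ℂ,
    (∀ k, IsTestFunction D (φ k)) ∧
    Tendsto (fun k => eLpNorm (φ k - u) 2 (volume.restrict D)) atTop (𝓝 0) ∧
    Tendsto (fun k => eLpNorm (classicalGrad (φ k) - weakGrad D u) 2 (volume.restrict D))
      atTop (𝓝 0)

/-- `u` is nontrivial: it is not a.e. zero on `D`. -/
def IsNontrivialOn {n : ℕ} (D : Set (EuclideanSpace ℝ (Fin n)))
    (u : EuclideanSpace ℝ (Fin n) → ℂ) : Prop :=
  ¬ u =ᵐ[volume.restrict D] 0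

/-- `-Δu = V u` on `D` in the sense of distributions, for `u ∈ W^{1,2}(D)`:
`∫_D ∇u · ∇ψ = ∫_D V u ψ` for all test functions, all integrals on the right being convergent. -/
def IsDistribSolution {n : ℕ} (D : Set (EuclideanSpace ℝ (Fin n)))
    (V : EuclideanSpace ℝ (Fin n) → ℝ) (u : EuclideanSpace ℝ (Fin n) → ℂ) : Prop :=
  ∀ ψ : EuclideanSpace ℝ (Fin n) → ℂ, IsTestFunction D ψ →
    IntegrableOn (fun x => (V x : ℂ) * u x * ψ x) D ∧
    ∫ x in D, ∑ i, weakGrad D u x i * classicalGrad ψ x i = ∫ x in D, (V x : ℂ) * u x * ψ x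

/-- The Sobolev constant `K_q(D)`, the supremum of `‖u‖_{2q} / ‖∇u‖₂` over the nontrivial
`u ∈ W₀^{1,2}(D)`, as an extended nonnegative real. -/
def sobolevConst {n : ℕ} (D : Set (EuclideanSpace ℝ (Fin n))) (q : ℝ≥0∞) : ℝ≥0∞ :=
  ⨆ (u : EuclideanSpace ℝ (Fin n) → ℂ) (_ : MemW012 D u) (_ : IsNontrivialOn D u),
    eLpNorm u (2 * q) (volume.restrict D) / eLpNorm (weakGrad D u) 2 (volume.restrict D)

/-- `u` attains the supremum that defines `K_q(D)`. -/
structure IsSobolevExtremal {n : ℕ} (D : Set (EuclideanSpace ℝ (Fin n))) (q : ℝ≥0∞)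
    (u : EuclideanSpace ℝ (Fin n) → ℂ) : Prop where
  mem : MemW012 D u
  nontrivial : IsNontrivialOn D u
  eq : sobolevConst D q =
    eLpNorm u (2 * q) (volume.restrict D) / eLpNorm (weakGrad D u) 2 (volume.restrict D)

/-- The potential `‖∇u‖₂² |u|^{2q-2} / ‖u‖_{2q}^{2q}` (for `q < ∞`). -/
def extremalPotential {n : ℕ} (D : Set (EuclideanSpace ℝ (Fin n))) (q : ℝ≥0∞)
    (u : EuclideanSpace ℝ (Fin n) → ℂ) (x : EuclideanSpace ℝ (Fin n)) : ℝ :=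
  (eLpNorm (weakGrad D u) 2 (volume.restrict D)).toReal ^ 2 /
      (eLpNorm u (2 * q) (volume.restrict D)).toReal ^ (2 * q.toReal) *
    ‖u x‖ ^ (2 * q.toReal - 2)

end

/-! Part (a) comes from testing the equation with the conjugate of `u`: `∫|∇u|² = ∫V|u|² ≤ ‖V₊‖_r
‖u‖_{2q}² ≤ K² ‖V₊‖_r ‖∇u‖₂²`, by Hölder and the definition of `K`; then `‖∇u‖₂² ≠ 0` is cancelled.
Only test functions are admissible, so `u` is approximated by them. Both sides converge because `Vu`
lies in the dual of `L^{2q}` and gradient convergence forces convergence in `L^{2q}`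
(`MemW012.tendsto_eLpNorm_sub`).

Finiteness of `K` is the subcritical Sobolev inequality
`exists_eLpNorm_le_mul_eLpNorm_classicalGrad`: `r > n/2` says exactly that `1/(2q) > 1/2 - 1/n`.

For an extremal, take test functions with `‖∇φ_k‖₂ = 1` and `‖φ_k‖_{2q} → K`. Rellich's theorem in
`L²`, proved with averages over the cubes of a fine grid, and interpolation with a slightly larger
subcritical exponent give a subsequence that is Cauchy in `L^{2q}`. No weak limits are needed: `‖φ_j
+ φ_k‖_{2q} → 2K` forces `‖∇φ_j + ∇φ_k‖₂ → 2`, so by the parallelogram law the gradients are Cauchy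
(`cauchySeq_of_maximizing`) and the strong limit is extremal.

For the equation, the potential `V` of an extremal is nonnegative and satisfies `K²‖V‖_r = 1`. Hence
the form `∫|∇v|² - ∫V|v|²` is nonnegative on `W₀^{1,2}` and vanishes at the extremal, which
therefore minimizes it. Vanishing of the first variation of this quadratic form is the equation
(`isDistribSolution_of_integral_eq`); the `L^{2q}` norm is never differentiated. -/

/-! ### Calculus of test functions and their gradients. -/

section TestFunctions

variable {n : ℕ} {D : Set (EuclideanSpace ℝ (Fin n))} {φ ψ : EuclideanSpace ℝ (Fin n) → ℂ}

namespace IsTestFunction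

theorem differentiable (h : IsTestFunction D φ) : Differentiable ℝ φ :=
  h.contDiff.differentiable (by simp)

theorem contDiff_one (h : IsTestFunction D φ) : ContDiff ℝ 1 φ :=
  h.contDiff.of_le (by simp)

theorem continuous (h : IsTestFunction D φ) : Continuous φ := h.contDiff.continuous

theorem add (h : IsTestFunction D φ) (h' : IsTestFunction D ψ) : IsTestFunction D (φ + ψ) where
  contDiff := h.contDiff.add h'.contDiff
  hasCompactSupport := h.hasCompactSupport.add h'.hasCompactSupport
  tsupport_subset :=
    (tsupport_add φ ψ).trans (Set.union_subset h.tsupport_subset h'.tsupport_subset)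

theorem const_smul (h : IsTestFunction D φ) (c : ℂ) : IsTestFunction D (c • φ) where
  contDiff := contDiff_const.smul h.contDiff
  hasCompactSupport := h.hasCompactSupport.smul_left (f := fun _ => c)
  tsupport_subset := (tsupport_smul_subset_right (fun _ => c) φ).trans h.tsupport_subset

theorem neg (h : IsTestFunction D φ) : IsTestFunction D (-φ) := by
  simpa using h.const_smul (-1)

theorem sub (h : IsTestFunction D φ) (h' : IsTestFunction D ψ) : IsTestFunction D (φ - ψ) := by
  simpa [sub_eq_add_neg] using h.add h'.neg

theorem conj (h : IsTestFunction D φ) :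
    IsTestFunction D (fun x => (starRingEnd ℂ) (φ x)) where
  contDiff := Complex.conjCLE.contDiff.comp h.contDiff
  hasCompactSupport := h.hasCompactSupport.comp_left (g := starRingEnd ℂ) (map_zero _)
  tsupport_subset :=
    (closure_mono (Function.support_comp_subset (map_zero (starRingEnd ℂ)) φ)).trans
      h.tsupport_subset

end IsTestFunction

theorem classicalGrad_apply (φ : EuclideanSpace ℝ (Fin n) → ℂ) (x : EuclideanSpace ℝ (Fin n))
    (i : Fin n) : classicalGrad φ x i = fderiv ℝ φ x (EuclideanSpace.single i 1) := rfl

namespace IsTestFunction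

theorem classicalGrad_add (h : IsTestFunction D φ) (h' : IsTestFunction D ψ) :
    classicalGrad (φ + ψ) = classicalGrad φ + classicalGrad ψ := by
  ext x i
  simp [classicalGrad_apply, fderiv_add (h.differentiable x) (h'.differentiable x)]

theorem classicalGrad_const_smul (h : IsTestFunction D φ) (c : ℂ) :
    classicalGrad (c • φ) = c • classicalGrad φ := by
  ext x i
  simp [classicalGrad_apply, fderiv_const_smul (h.differentiable x)]

theorem classicalGrad_sub (h : IsTestFunction D φ) (h' : IsTestFunction D ψ) :
    classicalGrad (φ - ψ) = classicalGrad φ - classicalGrad ψ := by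
  ext x i
  simp [classicalGrad_apply, fderiv_sub (h.differentiable x) (h'.differentiable x)]

theorem classicalGrad_conj (h : IsTestFunction D φ) (x : EuclideanSpace ℝ (Fin n)) (i : Fin n) :
    classicalGrad (fun x => (starRingEnd ℂ) (φ x)) x i = (starRingEnd ℂ) (classicalGrad φ x i) := by
  have := (Complex.conjCLE.toContinuousLinearMap.hasFDerivAt.comp x
    (h.differentiable x).hasFDerivAt).fderiv
  simp only [classicalGrad_apply]
  exact congrArg (fun L : EuclideanSpace ℝ (Fin n) →L[ℝ] ℂ => L (EuclideanSpace.single i 1)) this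

theorem continuous_classicalGrad (h : IsTestFunction D φ) : Continuous (classicalGrad φ) := by
  have h1 := h.contDiff_one.continuous_fderiv (by simp)
  refine (PiLp.continuous_toLp 2 _).comp (continuous_pi fun i => ?_)
  exact h1.clm_apply continuous_const

theorem support_classicalGrad_subset : Function.support (classicalGrad φ) ⊆ tsupport φ := by
  intro x hx
  by_contra h
  apply hx
  have : fderiv ℝ φ x = 0 := by
    by_contra h0
    exact h (support_fderiv_subset ℝ (Function.mem_support.2 h0))
  ext i
  simp [classicalGrad_apply, this]

theorem hasCompactSupport_classicalGrad (h : IsTestFunction D φ) :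
    HasCompactSupport (classicalGrad φ) :=
  h.hasCompactSupport.of_isClosed_subset isClosed_closure
    (closure_minimal support_classicalGrad_subset isClosed_closure)

theorem support_subset (h : IsTestFunction D φ) : Function.support φ ⊆ D :=
  subset_closure.trans h.tsupport_subset

theorem support_classicalGrad_subset' (h : IsTestFunction D φ) :
    Function.support (classicalGrad φ) ⊆ D :=
  support_classicalGrad_subset.trans h.tsupport_subset

theorem memLp (h : IsTestFunction D φ) (p : ℝ≥0∞) : MemLp φ p volume :=
  h.continuous.memLp_of_hasCompactSupport h.hasCompactSupport

theorem memLp_classicalGrad (h : IsTestFunction D φ) (p : ℝ≥0∞) :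
    MemLp (classicalGrad φ) p volume :=
  h.continuous_classicalGrad.memLp_of_hasCompactSupport h.hasCompactSupport_classicalGrad

theorem eLpNorm_restrict (h : IsTestFunction D φ) (p : ℝ≥0∞) :
    eLpNorm φ p (volume.restrict D) = eLpNorm φ p volume :=
  eLpNorm_restrict_eq_of_support_subset h.support_subset

theorem eLpNorm_classicalGrad_restrict (h : IsTestFunction D φ) (p : ℝ≥0∞) :
    eLpNorm (classicalGrad φ) p (volume.restrict D) = eLpNorm (classicalGrad φ) p volume :=
  eLpNorm_restrict_eq_of_support_subset h.support_classicalGrad_subset'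

end IsTestFunction

theorem fderiv_apply_eq_sum (φ : EuclideanSpace ℝ (Fin n) → ℂ) (x v : EuclideanSpace ℝ (Fin n)) :
    fderiv ℝ φ x v = ∑ i, (v i : ℂ) * classicalGrad φ x i := by
  conv_lhs => rw [← (EuclideanSpace.basisFun (Fin n) ℝ).sum_repr v]
  simp [classicalGrad_apply]

/-- Cauchy–Schwarz over the coordinates. It converts bounds by the operator norm of the derivative
into bounds by the gradient; equality can fail because the values are complex. -/
theorem norm_fderiv_le_norm_classicalGrad (φ : EuclideanSpace ℝ (Fin n) → ℂ)
    (x : EuclideanSpace ℝ (Fin n)) : ‖fderiv ℝ φ x‖ ≤ ‖classicalGrad φ x‖ := by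
  refine ContinuousLinearMap.opNorm_le_bound _ (norm_nonneg _) fun v => ?_
  rw [fderiv_apply_eq_sum]
  calc ‖∑ i, (v i : ℂ) * classicalGrad φ x i‖ ≤ ∑ i, ‖classicalGrad φ x i‖ * ‖v i‖ := by
        refine (norm_sum_le _ _).trans (Finset.sum_le_sum fun i _ => ?_)
        rw [norm_mul, mul_comm]; simp
    _ ≤ √(∑ i, ‖classicalGrad φ x i‖ ^ 2) * √(∑ i, ‖v i‖ ^ 2) :=
        Real.sum_mul_le_sqrt_mul_sqrt _ _ _
    _ = _ := by rw [EuclideanSpace.norm_eq, EuclideanSpace.norm_eq]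

end TestFunctions

/-! ### The subcritical Sobolev inequality for test functions. -/

section SobolevTest

variable {n : ℕ} {D : Set (EuclideanSpace ℝ (Fin n))}

theorem eLpNorm_mono_exponent_of_isBounded (hD : Bornology.IsBounded D) {E : Type*}
    [NormedAddCommGroup E] {p s : ℝ≥0∞} (hps : p ≤ s) :
    ∃ C : ℝ≥0∞, C ≠ ⊤ ∧ ∀ f : EuclideanSpace ℝ (Fin n) → E,
      AEStronglyMeasurable f (volume.restrict D) →
      eLpNorm f p (volume.restrict D) ≤ C * eLpNorm f s (volume.restrict D) := by
  -- For `p = 0` the exponent of the volume would be `-1/s`, since `1 / 0 = 0`.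
  by_cases h0 : p = 0
  · exact ⟨0, by simp, fun f _ => by simp [h0]⟩
  refine ⟨volume D ^ (1 / p.toReal - 1 / s.toReal), ?_, fun f hf => ?_⟩
  · refine ENNReal.rpow_ne_top_of_nonneg ?_ hD.measure_lt_top.ne
    by_cases hs : s = ⊤
    · simp [hs]
    · rw [sub_nonneg]
      have := ENNReal.toReal_mono hs hps
      have hp : 0 < p.toReal := ENNReal.toReal_pos h0 (ne_top_of_le_ne_top hs hps)
      exact one_div_le_one_div_of_le hp this
  · have := eLpNorm_le_eLpNorm_mul_rpow_measure_univ hps hf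
    rwa [Measure.restrict_apply_univ, mul_comm] at this

/-- The fundamental theorem of calculus on a half-line, after identifying `EuclideanSpace ℝ (Fin 1)`
with `ℝ` isometrically. -/
theorem enorm_le_eLpNorm_classicalGrad_one {D : Set (EuclideanSpace ℝ (Fin 1))}
    {φ : EuclideanSpace ℝ (Fin 1) → ℂ} (h : IsTestFunction D φ) (x : EuclideanSpace ℝ (Fin 1)) :
    ‖φ x‖ₑ ≤ eLpNorm (classicalGrad φ) 1 volume := by
  let L : ℝ ≃ₗᵢ[ℝ] EuclideanSpace ℝ (Fin 1) := (OrthonormalBasis.singleton (Fin 1) ℝ).repr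
  have hf : ContDiff ℝ 1 (φ ∘ L) := h.contDiff_one.comp L.toContinuousLinearEquiv.contDiff
  have hc : HasCompactSupport (φ ∘ L) := h.hasCompactSupport.comp_homeomorph L.toHomeomorph
  have h1 := HasCompactSupport.enorm_le_lintegral_Ici_deriv hf hc (L.symm x)
  simp only [Function.comp_apply, LinearIsometryEquiv.apply_symm_apply] at h1
  refine h1.trans ((setLIntegral_le_lintegral _ _).trans ?_)
  rw [eLpNorm_one_eq_lintegral_enorm,
    ← L.measurePreserving.lintegral_comp_emb L.toHomeomorph.measurableEmbedding]
  refine lintegral_mono fun t => ?_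
  have hd : HasDerivAt (φ ∘ L) (fderiv ℝ φ (L t) (L 1)) t := by
    have := (h.differentiable (L t)).hasFDerivAt.comp t
      L.toContinuousLinearEquiv.hasFDerivAt
    exact this.hasDerivAt
  rw [hd.deriv]
  refine enorm_le_iff_norm_le.2 ?_
  refine (ContinuousLinearMap.le_opNorm _ _).trans ?_
  simpa using norm_fderiv_le_norm_classicalGrad φ (L t)

/-- Insert `1/r < 2/n` in `1/q = 1 - 1/r`. For `n ≥ 2` this also gives `1/r < 1`, so `q` is finite.
-/
theorem inv_two_lt_of_holderConjugate {q r : ℝ≥0∞} (hn : 2 ≤ n)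
    (hqr : ENNReal.HolderConjugate q r) (hr : (n : ℝ≥0∞) / 2 < r) :
    q ≠ ⊤ ∧ (2 : ℝ)⁻¹ < (n : ℝ)⁻¹ + (2 * q.toReal)⁻¹ := by
  have hn0 : (n : ℝ≥0∞) ≠ 0 := by simp; omega
  have hnr : (2 : ℝ) ≤ n := by exact_mod_cast hn
  have hsum : q⁻¹ + r⁻¹ = 1 := hqr.inv_add_inv_eq_one
  have hr' : r⁻¹ < 2 / n := by
    rw [ENNReal.inv_lt_iff_inv_lt, ENNReal.inv_div (by simp) (by simp)]
    exact hr
  have hlt : r⁻¹ < 1 := hr'.trans_le <| ENNReal.div_le_of_le_mul <| by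
    rw [one_mul]; exact_mod_cast hn
  have hq : q ≠ ⊤ := by
    rintro rfl
    rw [ENNReal.inv_top, zero_add] at hsum
    exact hlt.ne hsum
  refine ⟨hq, ?_⟩
  have hrt : r⁻¹ ≠ ⊤ := (hlt.trans ENNReal.one_lt_top).ne
  have hq0 : q⁻¹ ≠ ⊤ := fun h => by rw [h] at hsum; simp at hsum
  have h1 : q.toReal⁻¹ + (r⁻¹).toReal = 1 := by
    rw [← ENNReal.toReal_inv, ← ENNReal.toReal_add hq0 hrt, hsum, ENNReal.toReal_one]
  have h2 : (r⁻¹).toReal < 2 / n := by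
    have := (ENNReal.toReal_lt_toReal hrt (ENNReal.div_ne_top (by simp) hn0)).2 hr'
    simpa [ENNReal.toReal_div] using this
  rw [mul_inv]
  have h3 : (2 : ℝ) / n = 2 * (n : ℝ)⁻¹ := by ring
  linarith

/-- The Sobolev inequality for test functions on a bounded set, in the subcritical range. -/
theorem exists_eLpNorm_le_mul_eLpNorm_classicalGrad (hn : 1 ≤ n) (hD : Bornology.IsBounded D)
    {q r : ℝ≥0∞} (hqr : ENNReal.HolderConjugate q r) (hr : (n : ℝ≥0∞) / 2 < r) :
    ∃ C : ℝ≥0∞, C ≠ ⊤ ∧ ∀ φ, IsTestFunction D φ →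
      eLpNorm φ (2 * q) volume ≤ C * eLpNorm (classicalGrad φ) 2 volume := by
  rcases hn.eq_or_lt with rfl | hn2
  -- In dimension one the supremum is bounded by the `L¹` norm of the gradient; Hölder on the
  -- bounded set adjusts both exponents.
  · obtain ⟨C₁, hC₁, h₁⟩ :=
      eLpNorm_mono_exponent_of_isBounded (E := ℂ) hD (le_top : 2 * q ≤ ⊤)
    obtain ⟨C₂, hC₂, h₂⟩ := eLpNorm_mono_exponent_of_isBounded (E := EuclideanSpace ℂ (Fin 1)) hD
      (one_le_two : (1 : ℝ≥0∞) ≤ 2)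
    refine ⟨C₁ * C₂, ENNReal.mul_ne_top hC₁ hC₂, fun φ hφ => ?_⟩
    have e1 := h₁ φ hφ.continuous.aestronglyMeasurable
    have e2 := h₂ _ hφ.continuous_classicalGrad.aestronglyMeasurable
    rw [hφ.eLpNorm_restrict, hφ.eLpNorm_restrict] at e1
    rw [hφ.eLpNorm_classicalGrad_restrict, hφ.eLpNorm_classicalGrad_restrict] at e2
    have e3 : eLpNorm φ ⊤ volume ≤ eLpNorm (classicalGrad φ) 1 volume := by
      rw [eLpNorm_exponent_top]
      exact essSup_le_of_ae_le _ (Eventually.of_forall (enorm_le_eLpNorm_classicalGrad_one hφ))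
    calc _ ≤ C₁ * (C₂ * eLpNorm (classicalGrad φ) 2 volume) := by
          exact e1.trans (by gcongr; exact e3.trans e2)
      _ = _ := by rw [mul_assoc]
  · obtain ⟨hq, hlt⟩ := inv_two_lt_of_holderConjugate hn2 hqr hr
    have hnr : (2 : ℝ) ≤ n := by exact_mod_cast hn2
    -- `a` is `1/p` for the gradient exponent `p` of the Gagliardo–Nirenberg–Sobolev inequality: `a
    -- ≤ 1` gives `1 ≤ p`, `a > 1/2` gives `p < 2 ≤ n`, and `a ≤ 1/n + 1/(2q)` brings the exponent
    -- `2q` within reach.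
    set a : ℝ := min 1 ((n : ℝ)⁻¹ + (2 * q.toReal)⁻¹) with ha
    have ha1 : a ≤ 1 := min_le_left _ _
    have ha2 : (2 : ℝ)⁻¹ < a := lt_min (by norm_num) hlt
    have ha0 : 0 < a := by linarith [show (0 : ℝ) < 2⁻¹ by norm_num]
    let p : NNReal := ⟨a⁻¹, by positivity⟩
    have hp1 : 1 ≤ p := by
      rw [← NNReal.coe_le_coe]; exact (one_le_inv₀ ha0).2 ha1
    have hp2 : p < 2 := by
      rw [← NNReal.coe_lt_coe]; exact (inv_lt_comm₀ ha0 (by norm_num)).2 ha2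
    obtain ⟨C₂, hC₂, h₂⟩ := eLpNorm_mono_exponent_of_isBounded (E := EuclideanSpace ℂ (Fin n)) hD
      (show (p : ℝ≥0∞) ≤ 2 by exact_mod_cast hp2.le)
    let s : NNReal := 2 * q.toNNReal
    have hs : (s : ℝ≥0∞) = 2 * q := by simp [s, ENNReal.coe_toNNReal hq]
    refine ⟨eLpNormLESNormFDerivOfLeConst ℂ volume D p s * C₂,
      ENNReal.mul_ne_top ENNReal.coe_ne_top hC₂, fun φ hφ => ?_⟩
    have e2 := h₂ _ hφ.continuous_classicalGrad.aestronglyMeasurable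
    rw [hφ.eLpNorm_classicalGrad_restrict, hφ.eLpNorm_classicalGrad_restrict] at e2
    have e1 := eLpNorm_le_eLpNorm_fderiv_of_le (volume : Measure (EuclideanSpace ℝ (Fin n)))
      (p := p) (q := s) hφ.contDiff_one hφ.support_subset hp1
      (by rw [finrank_euclideanSpace_fin]
          exact_mod_cast hp2.trans_le (by exact_mod_cast hn2))
      (by
        rw [finrank_euclideanSpace_fin]
        have : ((s : ℝ))⁻¹ = (2 * q.toReal)⁻¹ := rfl
        rw [this]
        have : ((p⁻¹ : NNReal) : ℝ) = a := inv_inv a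
        have h3 := min_le_right 1 ((n : ℝ)⁻¹ + (2 * q.toReal)⁻¹)
        rw [← ha] at h3
        linarith) hD
    rw [hs] at e1
    have e3 : eLpNorm (fderiv ℝ φ) p volume ≤ eLpNorm (classicalGrad φ) p volume :=
      eLpNorm_mono fun x => norm_fderiv_le_norm_classicalGrad φ x
    rw [mul_assoc]
    exact e1.trans (by gcongr; exact e3.trans e2)

end SobolevTest

/-! ### Dual pairings and limits in `L^p`. -/

section LpPairing

variable {α : Type*} [MeasurableSpace α] {μ : Measure α}

theorem eLpNorm_mul_one_le {p q : ℝ≥0∞} [ENNReal.HolderConjugate p q] {f g : α → ℂ}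
    (hf : AEStronglyMeasurable f μ) (hg : AEStronglyMeasurable g μ) :
    eLpNorm (fun x => f x * g x) 1 μ ≤ eLpNorm f p μ * eLpNorm g q μ :=
  eLpNorm_smul_le_mul_eLpNorm (p := p) (q := q) (r := 1) (φ := f) (f := g) hg hf

theorem integrable_mul_of_holderConjugate {p q : ℝ≥0∞} [ENNReal.HolderConjugate p q]
    {f g : α → ℂ} (hf : MemLp f p μ) (hg : MemLp g q μ) : Integrable (fun x => f x * g x) μ :=
  memLp_one_iff_integrable.1 (hg.mul hf)

/-- Continuity of the `L^p`-`L^q` pairing in its first argument. -/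
theorem tendsto_integral_mul {p q : ℝ≥0∞} [ENNReal.HolderConjugate p q] {F : ℕ → α → ℂ}
    {f g : α → ℂ} (hF : ∀ k, MemLp (F k) p μ) (hf : MemLp f p μ) (hg : MemLp g q μ)
    (h : Tendsto (fun k => eLpNorm (F k - f) p μ) atTop (𝓝 0)) :
    Tendsto (fun k => ∫ x, F k x * g x ∂μ) atTop (𝓝 (∫ x, f x * g x ∂μ)) := by
  refine tendsto_integral_of_L1' _ (integrable_mul_of_holderConjugate hf hg).1
    (Eventually.of_forall fun k => integrable_mul_of_holderConjugate (hF k) hg) ?_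
  have h0 : Tendsto (fun k => eLpNorm (F k - f) p μ * eLpNorm g q μ) atTop (𝓝 0) := by
    simpa using ENNReal.Tendsto.mul_const h (Or.inr hg.eLpNorm_ne_top)
  refine tendsto_of_tendsto_of_tendsto_of_le_of_le tendsto_const_nhds h0
    (fun _ => bot_le) fun k => ?_
  refine le_trans (le_of_eq ?_) (eLpNorm_mul_one_le ((hF k).sub hf).1 hg.1)
  congr 1
  ext x
  simp [sub_mul]

theorem memLp_euclidean_apply {n : ℕ} {p : ℝ≥0∞} {g : α → EuclideanSpace ℂ (Fin n)}
    (hg : MemLp g p μ) (i : Fin n) : MemLp (fun x => g x i) p μ :=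
  hg.of_le ((EuclideanSpace.proj (𝕜 := ℂ) i).continuous.comp_aestronglyMeasurable hg.1)
    (Eventually.of_forall fun x => PiLp.norm_apply_le (g x) i)

theorem eLpNorm_euclidean_apply_le {n : ℕ} {p : ℝ≥0∞} (g : α → EuclideanSpace ℂ (Fin n))
    (i : Fin n) : eLpNorm (fun x => g x i) p μ ≤ eLpNorm g p μ :=
  eLpNorm_mono fun x => PiLp.norm_apply_le (g x) i

theorem tendsto_eLpNorm_apply {n : ℕ} {p : ℝ≥0∞} {G : ℕ → α → EuclideanSpace ℂ (Fin n)}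
    {g : α → EuclideanSpace ℂ (Fin n)}
    (h : Tendsto (fun k => eLpNorm (G k - g) p μ) atTop (𝓝 0)) (i : Fin n) :
    Tendsto (fun k => eLpNorm ((fun x => G k x i) - fun x => g x i) p μ) atTop (𝓝 0) :=
  tendsto_of_tendsto_of_tendsto_of_le_of_le tendsto_const_nhds h (fun _ => bot_le)
    fun k => eLpNorm_euclidean_apply_le (G k - g) i

theorem tendsto_eLpNorm_of_tendsto_sub {E : Type*} [NormedAddCommGroup E] {p : ℝ≥0∞}
    (hp : 1 ≤ p) {F : ℕ → α → E} {f : α → E} (hF : ∀ k, MemLp (F k) p μ) (hf : MemLp f p μ)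
    (h : Tendsto (fun k => eLpNorm (F k - f) p μ) atTop (𝓝 0)) :
    Tendsto (fun k => eLpNorm (F k) p μ) atTop (𝓝 (eLpNorm f p μ)) := by
  have : Fact (1 ≤ p) := ⟨hp⟩
  have h1 : Tendsto (fun k => (hF k).toLp (F k)) atTop (𝓝 (hf.toLp f)) := by
    rw [Lp.tendsto_Lp_iff_tendsto_eLpNorm'']
    exact h
  have h2 := (continuous_enorm.tendsto _).comp h1
  simpa [Function.comp_def, Lp.enorm_toLp] using h2

end LpPairing

/-! ### The space `W₀^{1,2}(D)` and the Sobolev constant. -/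

section SobolevSpace

variable {n : ℕ} {D : Set (EuclideanSpace ℝ (Fin n))} {u : EuclideanSpace ℝ (Fin n) → ℂ}
  {φ : EuclideanSpace ℝ (Fin n) → ℂ} {g g' : EuclideanSpace ℝ (Fin n) → EuclideanSpace ℂ (Fin n)}

theorem MemW12.memLp_weakGrad (h : MemW12 D u) : MemLp (weakGrad D u) 2 (volume.restrict D) := by
  rw [weakGrad, dif_pos h]
  exact h.2.choose_spec.1

theorem MemW12.isWeakGradient (h : MemW12 D u) : IsWeakGradient D u (weakGrad D u) := by
  rw [weakGrad, dif_pos h]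
  exact h.2.choose_spec.2

theorem isTestFunction_ofReal {η : EuclideanSpace ℝ (Fin n) → ℝ} (h1 : ContDiff ℝ ∞ η)
    (h2 : HasCompactSupport η) (h3 : tsupport η ⊆ D) : IsTestFunction D (fun x => (η x : ℂ)) where
  contDiff := Complex.ofRealCLM.contDiff.comp h1
  hasCompactSupport := h2.comp_left (g := Complex.ofReal) Complex.ofReal_zero
  tsupport_subset :=
    (closure_mono (Function.support_comp_subset Complex.ofReal_zero η)).trans h3

/-- The fundamental lemma of the calculus of variations in each component. As `weakGrad` is an
arbitrary choice, every identification of it rests on this uniqueness. -/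
theorem IsWeakGradient.ae_eq (hD : IsOpen D) (hb : Bornology.IsBounded D)
    (hg : MemLp g 2 (volume.restrict D)) (hg' : MemLp g' 2 (volume.restrict D))
    (h : IsWeakGradient D u g) (h' : IsWeakGradient D u g') : g =ᵐ[volume.restrict D] g' := by
  have : IsFiniteMeasure (volume.restrict D) := ⟨by simpa using hb.measure_lt_top⟩
  have key : ∀ i, ∀ᵐ x ∂volume.restrict D, g x i = g' x i := by
    intro i
    have hi := (memLp_euclidean_apply hg i).integrable one_le_two
    have hi' := (memLp_euclidean_apply hg' i).integrable one_le_two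
    have h0 : ∀ᵐ x ∂volume, x ∈ D → g x i - g' x i = 0 := by
      refine hD.ae_eq_zero_of_integral_contDiff_smul_eq_zero
        (IntegrableOn.locallyIntegrableOn (hi.sub hi')) fun η h1 h2 h3 => ?_
      have hη := isTestFunction_ofReal h1 h2 h3
      have e : ∫ x in D, g x i * (η x : ℂ) = ∫ x in D, g' x i * (η x : ℂ) :=
        neg_injective ((h _ hη i).symm.trans (h' _ hη i))
      have hη2 := (hη.memLp 2).restrict D
      have i1 := integrable_mul_of_holderConjugate (memLp_euclidean_apply hg i) hη2
      have i2 := integrable_mul_of_holderConjugate (memLp_euclidean_apply hg' i) hη2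
      rw [← setIntegral_eq_integral_of_forall_compl_eq_zero (s := D), ← sub_eq_zero.2 e,
        ← integral_sub i1 i2]
      · refine integral_congr_ae (Eventually.of_forall fun x => ?_)
        simp only [Complex.real_smul]
        ring
      · intro x hx
        rw [image_eq_zero_of_notMem_tsupport (fun hx' => hx (h3 hx')), zero_smul]
    rw [ae_restrict_iff' hD.measurableSet]
    filter_upwards [h0] with x hx hxD
    exact sub_eq_zero.1 (hx hxD)
  filter_upwards [ae_all_iff.2 key] with x hx
  ext i
  exact hx i

/-- Both integrals extend by zero to the whole space, where integration by parts leaves no boundary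
term, so the boundary of `D` plays no role. -/
theorem IsTestFunction.isWeakGradient (h : IsTestFunction D φ) :
    IsWeakGradient D φ (classicalGrad φ) := by
  intro ψ hψ i
  have r1 : ∫ x in D, φ x * classicalGrad ψ x i = ∫ x, φ x * classicalGrad ψ x i :=
    setIntegral_eq_integral_of_forall_compl_eq_zero fun x hx => by
      rw [Function.notMem_support.1 fun h' => hx (h.support_subset h'), zero_mul]
  have r2 : ∫ x in D, classicalGrad φ x i * ψ x = ∫ x, classicalGrad φ x i * ψ x :=
    setIntegral_eq_integral_of_forall_compl_eq_zero fun x hx => by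
      rw [Function.notMem_support.1 fun h' => hx (hψ.support_subset h'), mul_zero]
  rw [r1, r2]
  exact integral_mul_fderiv_eq_neg_fderiv_mul_of_integrable
    (integrable_mul_of_holderConjugate (p := 2) (q := 2)
      (memLp_euclidean_apply (h.memLp_classicalGrad 2) i) (hψ.memLp 2))
    (integrable_mul_of_holderConjugate (p := 2) (q := 2)
      (h.memLp 2) (memLp_euclidean_apply (hψ.memLp_classicalGrad 2) i))
    (integrable_mul_of_holderConjugate (p := 2) (q := 2) (h.memLp 2) (hψ.memLp 2))
    (fun x _ => h.differentiable x) fun x _ => hψ.differentiable x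

/-- An `L²` limit of test functions whose gradients converge in `L²` lies in `W₀^{1,2}`. -/
theorem memW012_of_tendsto (hD : IsOpen D) (hb : Bornology.IsBounded D)
    {φ : ℕ → EuclideanSpace ℝ (Fin n) → ℂ} (hφ : ∀ k, IsTestFunction D (φ k))
    (hu : MemLp u 2 (volume.restrict D)) (hg : MemLp g 2 (volume.restrict D))
    (h1 : Tendsto (fun k => eLpNorm (φ k - u) 2 (volume.restrict D)) atTop (𝓝 0))
    (h2 : Tendsto (fun k => eLpNorm (classicalGrad (φ k) - g) 2 (volume.restrict D))
      atTop (𝓝 0)) :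
    MemW012 D u ∧ weakGrad D u =ᵐ[volume.restrict D] g := by
  have hw : IsWeakGradient D u g := by
    intro ψ hψ i
    have hψ2 := (hψ.memLp 2).restrict D
    have hψg := memLp_euclidean_apply ((hψ.memLp_classicalGrad 2).restrict D) i
    have t1 := tendsto_integral_mul (fun k => ((hφ k).memLp 2).restrict D) hu hψg h1
    have t2 := tendsto_integral_mul
      (fun k => memLp_euclidean_apply (((hφ k).memLp_classicalGrad 2).restrict D) i)
      (memLp_euclidean_apply hg i) hψ2 (tendsto_eLpNorm_apply h2 i)
    refine tendsto_nhds_unique t1 ?_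
    simpa only [(hφ _).isWeakGradient ψ hψ i] using t2.neg
  have hW : MemW12 D u := ⟨hu, g, hg, hw⟩
  have hae : weakGrad D u =ᵐ[volume.restrict D] g :=
    hW.isWeakGradient.ae_eq hD hb hW.memLp_weakGrad hg hw
  refine ⟨⟨hW, φ, hφ, h1, h2.congr fun k => eLpNorm_congr_ae ?_⟩, hae⟩
  filter_upwards [hae] with x hx
  simp [hx]

theorem IsTestFunction.memW012 (hD : IsOpen D) (hb : Bornology.IsBounded D)
    (h : IsTestFunction D φ) :
    MemW012 D φ ∧ weakGrad D φ =ᵐ[volume.restrict D] classicalGrad φ :=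
  memW012_of_tendsto hD hb (fun _ => h) ((h.memLp 2).restrict D)
    ((h.memLp_classicalGrad 2).restrict D) (by simp) (by simp)

theorem MemW012.add_test (hD : IsOpen D) (hb : Bornology.IsBounded D) (hu : MemW012 D u)
    (h : IsTestFunction D φ) :
    MemW012 D (u + φ) ∧
      weakGrad D (u + φ) =ᵐ[volume.restrict D] weakGrad D u + classicalGrad φ := by
  obtain ⟨hW, η, hη, t1, t2⟩ := hu
  have hφ2 := (h.memLp 2).restrict D
  have hφg := (h.memLp_classicalGrad 2).restrict D
  refine memW012_of_tendsto hD hb (fun k => (hη k).add h) (hW.1.add hφ2)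
    (hW.memLp_weakGrad.add hφg) ?_ ?_
  · simpa using t1
  · simpa [(hη _).classicalGrad_add h] using t2

/-- A Sobolev inequality for test functions extends to `W₀^{1,2}`. -/
theorem MemW012.eLpNorm_le (hu : MemW012 D u) {p C : ℝ≥0∞} (hC : C ≠ ⊤)
    (h : ∀ φ, IsTestFunction D φ → eLpNorm φ p volume ≤ C * eLpNorm (classicalGrad φ) 2 volume) :
    eLpNorm u p (volume.restrict D) ≤ C * eLpNorm (weakGrad D u) 2 (volume.restrict D) := by
  obtain ⟨hW, φ, hφ, t1, t2⟩ := hu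
  -- Convergence in `L²` yields an a.e. convergent subsequence, to which Fatou applies in `L^p`;
  -- convergence in `L^p` need not be known.
  have hm : TendstoInMeasure (volume.restrict D) φ atTop u :=
    tendstoInMeasure_of_tendsto_eLpNorm (by simp)
      (fun k => (hφ k).continuous.aestronglyMeasurable) hW.1.1 t1
  obtain ⟨ns, hns, hae⟩ := hm.exists_seq_tendsto_ae
  have hF := Lp.eLpNorm_lim_le_liminf_eLpNorm (p := p) (μ := volume.restrict D)
    (f := fun k => φ (ns k)) (fun k => (hφ _).continuous.aestronglyMeasurable) u hae
  refine hF.trans ?_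
  have t3 := tendsto_eLpNorm_of_tendsto_sub one_le_two
    (fun k => ((hφ k).memLp_classicalGrad 2).restrict D) hW.memLp_weakGrad t2
  have t4 := ENNReal.Tendsto.const_mul (a := C) (t3.comp hns.tendsto_atTop) (Or.inr hC)
  rw [← t4.liminf_eq]
  refine liminf_le_liminf (Eventually.of_forall fun k => ?_)
  simp only [Function.comp_apply]
  rw [(hφ _).eLpNorm_restrict, (hφ _).eLpNorm_classicalGrad_restrict]
  exact h _ (hφ _)

theorem sobolevConst_le {q C : ℝ≥0∞} (hC : C ≠ ⊤)
    (h : ∀ φ, IsTestFunction D φ →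
      eLpNorm φ (2 * q) volume ≤ C * eLpNorm (classicalGrad φ) 2 volume) :
    sobolevConst D q ≤ C :=
  iSup_le fun _ => iSup_le fun hu => iSup_le fun _ =>
    ENNReal.div_le_of_le_mul (hu.eLpNorm_le hC h)

theorem sobolevConst_ne_top (hn : 1 ≤ n) (hb : Bornology.IsBounded D)
    {q r : ℝ≥0∞} (hqr : ENNReal.HolderConjugate q r) (hr : (n : ℝ≥0∞) / 2 < r) :
    sobolevConst D q ≠ ⊤ := by
  obtain ⟨C, hC, h⟩ := exists_eLpNorm_le_mul_eLpNorm_classicalGrad hn hb hqr hr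
  exact ne_top_of_le_ne_top hC (sobolevConst_le hC h)

/-- Any Sobolev inequality would force `u = 0` if the gradient vanished; `r = ∞` is always
admissible. It makes the quotients in `sobolevConst` genuine. -/
theorem MemW012.eLpNorm_weakGrad_ne_zero (hn : 1 ≤ n) (hb : Bornology.IsBounded D)
    (hu : MemW012 D u) (h0 : IsNontrivialOn D u) :
    eLpNorm (weakGrad D u) 2 (volume.restrict D) ≠ 0 := by
  intro h
  obtain ⟨r, hr, hr'⟩ : ∃ r : ℝ≥0∞, (n : ℝ≥0∞) / 2 < r ∧ 1 ≤ r :=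
    ⟨⊤, ENNReal.div_lt_top (by simp) (by simp), le_top⟩
  have : ENNReal.HolderConjugate r.conjExponent r := (ENNReal.HolderConjugate.conjExponent hr').symm
  obtain ⟨C, hC, h'⟩ := exists_eLpNorm_le_mul_eLpNorm_classicalGrad hn hb this hr
  have h1 := hu.eLpNorm_le hC h'
  rw [h, mul_zero, nonpos_iff_eq_zero, eLpNorm_eq_zero_iff hu.1.1.1] at h1
  · exact h0 h1
  · exact mul_ne_zero two_ne_zero
      (ENNReal.HolderConjugate.ne_zero r.conjExponent r)

theorem MemW012.eLpNorm_le_sobolevConst (hn : 1 ≤ n) (hb : Bornology.IsBounded D)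
    (hu : MemW012 D u) {q : ℝ≥0∞} :
    eLpNorm u (2 * q) (volume.restrict D) ≤
      sobolevConst D q * eLpNorm (weakGrad D u) 2 (volume.restrict D) := by
  by_cases h0 : IsNontrivialOn D u
  · have hne := hu.eLpNorm_weakGrad_ne_zero hn hb h0
    rw [← ENNReal.div_le_iff hne hu.1.memLp_weakGrad.eLpNorm_ne_top]
    exact le_iSup_of_le u (le_iSup_of_le hu (le_iSup_of_le h0 le_rfl))
  · rw [IsNontrivialOn, not_not] at h0
    rw [eLpNorm_congr_ae h0]
    simp

theorem IsTestFunction.eLpNorm_le_sobolevConst (hn : 1 ≤ n) (hD : IsOpen D)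
    (hb : Bornology.IsBounded D) (h : IsTestFunction D φ) {q : ℝ≥0∞} :
    eLpNorm φ (2 * q) volume ≤ sobolevConst D q * eLpNorm (classicalGrad φ) 2 volume := by
  obtain ⟨h1, h2⟩ := h.memW012 hD hb
  have := h1.eLpNorm_le_sobolevConst hn hb (q := q)
  rwa [eLpNorm_congr_ae h2, h.eLpNorm_restrict, h.eLpNorm_classicalGrad_restrict] at this

/-- The Sobolev inequality applied to `u - φ k`, which lies in `W₀^{1,2}` as the sum of `u` and a
test function. -/
theorem MemW012.tendsto_eLpNorm_sub (hn : 1 ≤ n) (hD : IsOpen D) (hb : Bornology.IsBounded D)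
    {q : ℝ≥0∞} (hK : sobolevConst D q ≠ ⊤) (hu : MemW012 D u)
    {φ : ℕ → EuclideanSpace ℝ (Fin n) → ℂ} (hφ : ∀ k, IsTestFunction D (φ k))
    (h2 : Tendsto (fun k => eLpNorm (classicalGrad (φ k) - weakGrad D u) 2 (volume.restrict D))
      atTop (𝓝 0)) :
    Tendsto (fun k => eLpNorm (φ k - u) (2 * q) (volume.restrict D)) atTop (𝓝 0) := by
  have h0 := ENNReal.Tendsto.const_mul (a := sobolevConst D q) h2 (Or.inr hK)
  rw [mul_zero] at h0
  refine tendsto_of_tendsto_of_tendsto_of_le_of_le tendsto_const_nhds h0 (fun _ => bot_le)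
    fun k => ?_
  obtain ⟨m, e⟩ := hu.add_test hD hb (hφ k).neg
  have h3 := m.eLpNorm_le_sobolevConst hn hb (q := q)
  have e1 : φ k - u = -(u + -φ k) := by ring
  have e2 : classicalGrad (φ k) - weakGrad D u = -(weakGrad D u + classicalGrad (-φ k)) := by
    have := (hφ k).classicalGrad_const_smul (-1)
    simp only [neg_smul, one_smul] at this
    rw [this]
    abel
  rw [e1, eLpNorm_neg]
  dsimp only
  rw [e2, eLpNorm_neg, ← eLpNorm_congr_ae e]
  exact h3

theorem MemW012.memLp (hn : 1 ≤ n) (hb : Bornology.IsBounded D)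
    {q : ℝ≥0∞} (hK : sobolevConst D q ≠ ⊤) (hu : MemW012 D u) :
    MemLp u (2 * q) (volume.restrict D) :=
  ⟨hu.1.1.1, (hu.eLpNorm_le_sobolevConst hn hb).trans_lt
    (ENNReal.mul_lt_top hK.lt_top hu.1.memLp_weakGrad.2)⟩

end SobolevSpace

/-! ### A Poincaré inequality in terms of differences. -/

section LocalPoincare

variable {α : Type*} [MeasurableSpace α] {μ : Measure α}

theorem sq_lintegral_le {f : α → ℝ≥0∞} (hf : AEMeasurable f μ) :
    (∫⁻ x, f x ∂μ) ^ 2 ≤ μ Set.univ * ∫⁻ x, f x ^ 2 ∂μ := by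
  have h := ENNReal.lintegral_mul_le_Lp_mul_Lq μ Real.HolderConjugate.two_two
    (aemeasurable_const (b := (1 : ℝ≥0∞))) hf
  simp only [Pi.mul_apply, one_mul, ENNReal.one_rpow, lintegral_one] at h
  calc (∫⁻ x, f x ∂μ) ^ 2
      ≤ (μ Set.univ ^ (1 / 2 : ℝ) * (∫⁻ x, f x ^ (2 : ℝ) ∂μ) ^ (1 / 2 : ℝ)) ^ 2 := by gcongr
    _ = _ := by
      rw [mul_pow, ← ENNReal.rpow_mul_natCast, ← ENNReal.rpow_mul_natCast]
      norm_num

theorem ennreal_add_sq_le (a b : ℝ≥0∞) : (a + b) ^ 2 ≤ 2 * a ^ 2 + 2 * b ^ 2 := by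
  have := ENNReal.rpow_add_le_mul_rpow_add_rpow a b (p := 2) (by norm_num)
  norm_num at this
  rwa [mul_add] at this

/-- A Poincaré inequality with the differences of a function in place of its gradient. -/
theorem measure_mul_lintegral_enorm_sq_le [IsFiniteMeasure μ] {w : α → ℂ}
    (hw : Integrable w μ) :
    μ Set.univ * ∫⁻ x, ‖w x‖ₑ ^ 2 ∂μ ≤
      2 * ∫⁻ x, ∫⁻ y, ‖w x - w y‖ₑ ^ 2 ∂μ ∂μ + 2 * ‖∫ x, w x ∂μ‖ₑ ^ 2 := by
  set m := μ Set.univ with hm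
  have hmt : m ≠ ⊤ := measure_ne_top μ _
  by_cases hm0 : m = 0
  · simp [hm0]
  have key : ∀ x, m ^ 2 * ‖w x‖ₑ ^ 2 ≤
      2 * (m * ∫⁻ y, ‖w x - w y‖ₑ ^ 2 ∂μ) + 2 * ‖∫ x, w x ∂μ‖ₑ ^ 2 := by
    intro x
    have hc : Integrable (fun _ => w x) μ := integrable_const _
    -- The total mass times `w x` is the integral of `w x - w y` in `y` plus the integral of `w`.
    -- Squaring and integrating in `x` costs a factor `m`, cancelled at the end.
    have e : (m.toReal : ℂ) * w x = (∫ y, (w x - w y) ∂μ) + ∫ y, w y ∂μ := by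
      rw [integral_sub hc hw, integral_const, sub_add_cancel, Complex.real_smul]
      rfl
    have e1 : m * ‖w x‖ₑ ≤ (∫⁻ y, ‖w x - w y‖ₑ ∂μ) + ‖∫ y, w y ∂μ‖ₑ := by
      have h1 : ‖(m.toReal : ℂ)‖ₑ = m := by
        rw [← ofReal_norm, Complex.norm_real, Real.norm_of_nonneg ENNReal.toReal_nonneg,
          ENNReal.ofReal_toReal hmt]
      calc m * ‖w x‖ₑ = ‖(m.toReal : ℂ) * w x‖ₑ := by rw [enorm_mul, h1]
        _ ≤ ‖∫ y, (w x - w y) ∂μ‖ₑ + ‖∫ y, w y ∂μ‖ₑ := by rw [e]; exact enorm_add_le _ _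
        _ ≤ _ := by gcongr; exact enorm_integral_le_lintegral_enorm _
    rw [← mul_pow]
    refine (pow_le_pow_left₀ (zero_le) e1 2).trans ((ennreal_add_sq_le _ _).trans ?_)
    gcongr
    exact sq_lintegral_le (hc.sub hw).1.enorm
  have h2 : m ^ 2 * ∫⁻ x, ‖w x‖ₑ ^ 2 ∂μ ≤
      m * (2 * ∫⁻ x, ∫⁻ y, ‖w x - w y‖ₑ ^ 2 ∂μ ∂μ + 2 * ‖∫ x, w x ∂μ‖ₑ ^ 2) := by
    rw [← lintegral_const_mul' _ _ (ENNReal.pow_ne_top hmt)]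
    refine (lintegral_mono key).trans (le_of_eq ?_)
    rw [lintegral_add_right _ measurable_const, lintegral_const, lintegral_const_mul' _ _ (by simp),
      lintegral_const_mul' _ _ hmt]
    ring
  rw [pow_two, mul_assoc] at h2
  exact (ENNReal.mul_le_mul_iff_right hm0 hmt).1 h2

end LocalPoincare

/-! ### Translation estimates in `L²`. -/

section Translation

variable {n : ℕ} {D : Set (EuclideanSpace ℝ (Fin n))} {φ : EuclideanSpace ℝ (Fin n) → ℂ}

/-- The fundamental theorem of calculus along the segment from `x` to `x + z`, then Cauchy–Schwarz
on the unit interval. -/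
theorem IsTestFunction.enorm_sub_sq_le (h : IsTestFunction D φ) (x z : EuclideanSpace ℝ (Fin n)) :
    ‖φ (x + z) - φ x‖ₑ ^ 2 ≤
      ∫⁻ t in Set.Ioc (0 : ℝ) 1, ‖z‖ₑ ^ 2 * ‖classicalGrad φ (x + t • z)‖ₑ ^ 2 := by
  have hc : Continuous fun t : ℝ => classicalGrad φ (x + t • z) :=
    h.continuous_classicalGrad.comp (by fun_prop)
  have hd : ∀ t : ℝ, HasDerivAt (fun t : ℝ => φ (x + t • z)) (fderiv ℝ φ (x + t • z) z) t := by
    intro t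
    have h1 : HasDerivAt (fun t : ℝ => x + t • z) z t := by
      simpa using ((hasDerivAt_id t).smul_const z).const_add x
    exact (h.differentiable _).hasFDerivAt.comp_hasDerivAt t h1
  have hcd : Continuous fun t : ℝ => fderiv ℝ φ (x + t • z) z :=
    ((h.contDiff_one.continuous_fderiv (by simp)).comp (by fun_prop)).clm_apply continuous_const
  have e : φ (x + z) - φ x = ∫ t in Set.Ioc (0 : ℝ) 1, fderiv ℝ φ (x + t • z) z := by
    have := intervalIntegral.integral_eq_sub_of_hasDerivAt (a := 0) (b := 1)
      (fun t _ => hd t) (hcd.intervalIntegrable _ _)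
    rw [intervalIntegral.integral_of_le zero_le_one] at this
    simpa using this.symm
  have e1 : ‖φ (x + z) - φ x‖ₑ ≤
      ∫⁻ t in Set.Ioc (0 : ℝ) 1, ‖z‖ₑ * ‖classicalGrad φ (x + t • z)‖ₑ := by
    rw [e]
    refine (enorm_integral_le_lintegral_enorm _).trans (lintegral_mono fun t => ?_)
    rw [mul_comm]
    refine (ContinuousLinearMap.le_opENorm _ _).trans ?_
    gcongr
    exact enorm_le_iff_norm_le.2 (norm_fderiv_le_norm_classicalGrad _ _)
  refine (pow_le_pow_left₀ (zero_le) e1 2).trans ((sq_lintegral_le ?_).trans ?_)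
  · exact (continuous_const.enorm.measurable.mul hc.enorm.measurable).aemeasurable
  · simp [mul_pow]

/-- The translation estimate `‖φ(· + z) - φ‖₂ ≤ |z| ‖∇φ‖₂`. -/
theorem IsTestFunction.lintegral_enorm_sub_sq_le (h : IsTestFunction D φ)
    (z : EuclideanSpace ℝ (Fin n)) :
    ∫⁻ x, ‖φ (x + z) - φ x‖ₑ ^ 2 ≤ ‖z‖ₑ ^ 2 * ∫⁻ x, ‖classicalGrad φ x‖ₑ ^ 2 := by
  refine (lintegral_mono fun x => h.enorm_sub_sq_le x z).trans ?_
  have hm : Measurable fun p : EuclideanSpace ℝ (Fin n) × ℝ =>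
      ‖z‖ₑ ^ 2 * ‖classicalGrad φ (p.1 + p.2 • z)‖ₑ ^ 2 := by
    have : Continuous fun p : EuclideanSpace ℝ (Fin n) × ℝ => classicalGrad φ (p.1 + p.2 • z) :=
      h.continuous_classicalGrad.comp (by fun_prop)
    exact (this.enorm.measurable.pow_const 2).const_mul _
  -- With the `x`-integral inside, translation invariance removes the dependence on `t`.
  rw [lintegral_lintegral_swap hm.aemeasurable]
  have : ∀ t : ℝ, ∫⁻ x, ‖z‖ₑ ^ 2 * ‖classicalGrad φ (x + t • z)‖ₑ ^ 2 =
      ‖z‖ₑ ^ 2 * ∫⁻ x, ‖classicalGrad φ x‖ₑ ^ 2 := by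
    intro t
    rw [lintegral_const_mul' _ _ (by simp),
      lintegral_add_right_eq_self (fun x => ‖classicalGrad φ x‖ₑ ^ 2) (t • z)]
  simp [this]

end Translation

/-! ### The grid of cubes of side `h`. -/

section Cubes

variable {n : ℕ}

/-- The half-open cube of side `h` with index `c` in the grid `h ℤⁿ`. -/
def gridCube (h : ℝ) (c : Fin n → ℤ) : Set (EuclideanSpace ℝ (Fin n)) :=
  {x | (fun i => ⌊x i / h⌋) = c}

theorem measurableSet_gridCube (h : ℝ) (c : Fin n → ℤ) : MeasurableSet (gridCube h c) := by
  have : Measurable fun (x : EuclideanSpace ℝ (Fin n)) (i : Fin n) => ⌊x i / h⌋ := by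
    refine measurable_pi_lambda _ fun i => Int.measurable_floor.comp ?_
    exact ((EuclideanSpace.proj (𝕜 := ℝ) i).continuous.measurable).div_const h
  exact this (measurableSet_singleton c)

theorem pairwise_disjoint_gridCube (h : ℝ) :
    Pairwise (Function.onFun Disjoint (gridCube (n := n) h)) := fun _ _ hab =>
  Set.disjoint_left.2 fun _ hx hy => hab (hx.symm.trans hy)

theorem iUnion_gridCube (h : ℝ) : ⋃ c, gridCube (n := n) h c = Set.univ :=
  Set.eq_univ_of_forall fun x => Set.mem_iUnion.2 ⟨fun i => ⌊x i / h⌋, rfl⟩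

theorem lintegral_eq_tsum_gridCube (h : ℝ) (f : EuclideanSpace ℝ (Fin n) → ℝ≥0∞) :
    ∫⁻ x, f x = ∑' c, ∫⁻ x in gridCube h c, f x := by
  rw [← lintegral_iUnion (measurableSet_gridCube h) (pairwise_disjoint_gridCube h),
    iUnion_gridCube, setLIntegral_univ]

theorem volume_gridCube {h : ℝ} (hh : 0 < h) (c : Fin n → ℤ) :
    volume (gridCube h c) = ENNReal.ofReal h ^ n := by
  have e : gridCube h c = (MeasurableEquiv.toLp 2 (Fin n → ℝ)).symm ⁻¹'
      (Set.univ.pi fun i => Set.Ico ((c i : ℝ) * h) ((c i + 1 : ℝ) * h)) := by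
    ext x
    simp only [gridCube, Set.mem_ofPred_eq, funext_iff, Int.floor_eq_iff, Set.mem_preimage,
      Set.mem_pi, Set.mem_univ, true_imp_iff, Set.mem_Ico, le_div_iff₀ hh, div_lt_iff₀ hh]
    rfl
  rw [e, (EuclideanSpace.volume_preserving_symm_measurableEquiv_toLp (Fin n)).measure_preimage
    (MeasurableSet.univ_pi fun _ => measurableSet_Ico).nullMeasurableSet, Real.volume_pi_Ico]
  simp [add_mul]

theorem norm_sub_le_of_mem_gridCube {h : ℝ} (hh : 0 < h) {c : Fin n → ℤ}
    {x y : EuclideanSpace ℝ (Fin n)} (hx : x ∈ gridCube h c) (hy : y ∈ gridCube h c) :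
    ‖y - x‖ ≤ n * h := by
  have key : ∀ i, |y i - x i| ≤ h := by
    intro i
    have h1 := congrFun hx i
    have h2 := congrFun hy i
    simp only [Int.floor_eq_iff, le_div_iff₀ hh, div_lt_iff₀ hh] at h1 h2
    rw [abs_le]
    constructor <;> nlinarith [h1.1, h1.2, h2.1, h2.2]
  calc ‖y - x‖ = ‖∑ i, (y - x) i • EuclideanSpace.basisFun (Fin n) ℝ i‖ := by
        congr 1
        exact ((EuclideanSpace.basisFun (Fin n) ℝ).sum_repr (y - x)).symm
    _ ≤ ∑ _i : Fin n, h := by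
        refine (norm_sum_le _ _).trans (Finset.sum_le_sum fun i _ => ?_)
        rw [norm_smul]
        simpa using key i
    _ = n * h := by simp

/-- Only finitely many averages matter for functions supported in a bounded set, so convergence of
each average passes to the sum. -/
theorem finite_gridCube_inter {D : Set (EuclideanSpace ℝ (Fin n))} (hD : Bornology.IsBounded D)
    {h : ℝ} (hh : 0 < h) : {c : Fin n → ℤ | (gridCube h c ∩ D).Nonempty}.Finite := by
  obtain ⟨R, hR⟩ := hD.exists_norm_le
  refine (Set.finite_Icc (fun _ : Fin n => ⌊-R / h⌋) (fun _ => ⌊R / h⌋)).subset ?_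
  rintro c ⟨x, hxc, hxD⟩
  have hx : ∀ i, |x i| ≤ R := fun i => (PiLp.norm_apply_le x i).trans (hR x hxD)
  rw [← hxc]
  refine ⟨fun i => Int.floor_le_floor ?_, fun i => Int.floor_le_floor ?_⟩
  · have := (abs_le.1 (hx i)).1
    gcongr
  · have := (abs_le.1 (hx i)).2
    gcongr

/-- Put `y = x + z`: two points of one cube differ by at most `n * h`, so enlarging the inner domain
to that ball loses nothing, and summing over the disjoint cubes restores the full integral in `x`.
-/
theorem tsum_lintegral_gridCube_le {h : ℝ} (hh : 0 < h)
    {F : EuclideanSpace ℝ (Fin n) → EuclideanSpace ℝ (Fin n) → ℝ≥0∞}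
    (hF : Measurable (Function.uncurry F)) :
    ∑' c, ∫⁻ x in gridCube h c, ∫⁻ y in gridCube h c, F x y ≤
      ∫⁻ z in Metric.closedBall 0 (n * h), ∫⁻ x, F x (x + z) := by
  have h1 : ∀ c, ∫⁻ x in gridCube h c, ∫⁻ y in gridCube h c, F x y ≤
      ∫⁻ x in gridCube h c, ∫⁻ z in Metric.closedBall 0 (n * h), F x (x + z) := by
    intro c
    refine setLIntegral_mono' (measurableSet_gridCube h c) fun x hx => ?_
    rw [← lintegral_indicator (measurableSet_gridCube h c),
      ← lintegral_indicator Metric.isClosed_closedBall.measurableSet,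
      ← lintegral_add_left_eq_self _ x]
    refine lintegral_mono fun z => ?_
    by_cases hz : x + z ∈ gridCube h c
    · have hz' : z ∈ Metric.closedBall (0 : EuclideanSpace ℝ (Fin n)) (n * h) := by
        rw [mem_closedBall_zero_iff]
        simpa using norm_sub_le_of_mem_gridCube hh hx hz
      simp [Set.indicator_of_mem hz, Set.indicator_of_mem hz']
    · simp [Set.indicator_of_notMem hz]
  refine (ENNReal.tsum_le_tsum h1).trans ?_
  rw [← lintegral_eq_tsum_gridCube]
  refine le_of_eq (lintegral_lintegral_swap ?_)
  exact (hF.comp (measurable_fst.prodMk (measurable_fst.add measurable_snd))).aemeasurable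

end Cubes

/-! ### Rellich's theorem in `L²`. -/

section Rellich

variable {n : ℕ} {D : Set (EuclideanSpace ℝ (Fin n))}

/-- A Friedrichs inequality: the `L²` norm is controlled by a small multiple of the norm of the
gradient and the averages over the cubes of a grid. -/
theorem exists_lintegral_sq_le_gridCube (hn : 1 ≤ n) :
    ∃ C : ℝ≥0∞, C ≠ ⊤ ∧ ∀ h : ℝ, 0 < h → ∀ φ : EuclideanSpace ℝ (Fin n) → ℂ,
      IsTestFunction D φ →
      ∫⁻ x, ‖φ x‖ₑ ^ 2 ≤ C * ENNReal.ofReal h ^ 2 * (∫⁻ x, ‖classicalGrad φ x‖ₑ ^ 2) +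
        (ENNReal.ofReal h ^ n)⁻¹ * (2 * ∑' c, ‖∫ x in gridCube h c, φ x‖ₑ ^ 2) := by
  have : Nonempty (Fin n) := ⟨⟨0, hn⟩⟩
  -- Twice the volume of a ball of radius `n h`, times the translation factor `(n h)²`, divided by
  -- the cube volume `h ^ n` and with `h²` split off.
  refine ⟨2 * ((n : ℝ≥0∞) ^ n * volume (Metric.ball (0 : EuclideanSpace ℝ (Fin n)) 1) * n ^ 2),
    ?_, fun h hh φ hφ => ?_⟩
  · refine ENNReal.mul_ne_top (by simp) (ENNReal.mul_ne_top (ENNReal.mul_ne_top (by simp) ?_)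
      (by simp))
    exact Metric.isBounded_ball.measure_lt_top.ne
  set m : ℝ≥0∞ := ENNReal.ofReal h ^ n with hm
  set G := ∫⁻ x, ‖classicalGrad φ x‖ₑ ^ 2
  have hm0 : m ≠ 0 := pow_ne_zero _ (by simpa using hh)
  have hmt : m ≠ ⊤ := by simp [hm]
  have hint : Integrable φ volume := memLp_one_iff_integrable.1 (hφ.memLp 1)
  have hcube : ∀ c : Fin n → ℤ, m * ∫⁻ x in gridCube h c, ‖φ x‖ₑ ^ 2 ≤
      2 * (∫⁻ x in gridCube h c, ∫⁻ y in gridCube h c, ‖φ x - φ y‖ₑ ^ 2) +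
        2 * ‖∫ x in gridCube h c, φ x‖ₑ ^ 2 := by
    intro c
    have hv := volume_gridCube hh c
    have : IsFiniteMeasure (volume.restrict (gridCube h c)) :=
      ⟨by rw [Measure.restrict_apply_univ, hv]; exact hmt.lt_top⟩
    have := measure_mul_lintegral_enorm_sq_le (hint.restrict (s := gridCube h c))
    rwa [Measure.restrict_apply_univ, hv] at this
  have hF : Measurable (Function.uncurry fun x y => ‖φ x - φ y‖ₑ ^ 2) := by
    have : Continuous fun p : EuclideanSpace ℝ (Fin n) × EuclideanSpace ℝ (Fin n) =>
        φ p.1 - φ p.2 := (hφ.continuous.comp continuous_fst).sub (hφ.continuous.comp continuous_snd)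
    exact this.enorm.measurable.pow_const 2
  have hball : ∫⁻ z in Metric.closedBall (0 : EuclideanSpace ℝ (Fin n)) (n * h),
      ∫⁻ x, ‖φ x - φ (x + z)‖ₑ ^ 2 ≤
        m * ((n : ℝ≥0∞) ^ n * volume (Metric.ball (0 : EuclideanSpace ℝ (Fin n)) 1) * n ^ 2 *
          ENNReal.ofReal h ^ 2 * G) := by
    calc _ ≤ ∫⁻ z in Metric.closedBall (0 : EuclideanSpace ℝ (Fin n)) (n * h),
          ENNReal.ofReal (n * h) ^ 2 * G := by
          refine setLIntegral_mono' Metric.isClosed_closedBall.measurableSet fun z hz => ?_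
          simp_rw [enorm_sub_rev (φ _) (φ (_ + z))]
          refine (hφ.lintegral_enorm_sub_sq_le z).trans ?_
          gcongr
          rw [← ofReal_norm]
          exact ENNReal.ofReal_le_ofReal (mem_closedBall_zero_iff.1 hz)
      _ = _ := by
          rw [lintegral_const, Measure.restrict_apply_univ,
            Measure.addHaar_closedBall _ _ (by positivity), finrank_euclideanSpace_fin,
            ENNReal.ofReal_pow (by positivity), ENNReal.ofReal_mul (by positivity),
            ENNReal.ofReal_natCast, hm]
          ring
  have hsum : m * ∫⁻ x, ‖φ x‖ₑ ^ 2 ≤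
      2 * (m * ((n : ℝ≥0∞) ^ n * volume (Metric.ball (0 : EuclideanSpace ℝ (Fin n)) 1) * n ^ 2 *
          ENNReal.ofReal h ^ 2 * G)) + 2 * ∑' c, ‖∫ x in gridCube h c, φ x‖ₑ ^ 2 := by
    rw [lintegral_eq_tsum_gridCube h, ← ENNReal.tsum_mul_left]
    refine (ENNReal.tsum_le_tsum hcube).trans ?_
    rw [ENNReal.tsum_add, ENNReal.tsum_mul_left, ENNReal.tsum_mul_left]
    gcongr
    exact (tsum_lintegral_gridCube_le hh hF).trans hball
  rw [← ENNReal.mul_le_mul_iff_right hm0 hmt, mul_add, ← mul_assoc m m⁻¹,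
    ENNReal.mul_inv_cancel hm0 hmt, one_mul]
  refine hsum.trans (le_of_eq ?_)
  ring

theorem eLpNorm_two_sq {α E : Type*} [MeasurableSpace α] {μ : Measure α} [NormedAddCommGroup E]
    (f : α → E) : eLpNorm f 2 μ ^ 2 = ∫⁻ x, ‖f x‖ₑ ^ 2 ∂μ := by
  have := eLpNorm_nnreal_pow_eq_lintegral (f := f) (μ := μ) (p := 2) (by simp)
  simpa using this

theorem exists_eLpNorm_two_le (hn : 1 ≤ n) (hb : Bornology.IsBounded D) :
    ∃ C : ℝ≥0∞, C ≠ ⊤ ∧ ∀ φ, IsTestFunction D φ →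
      eLpNorm φ 2 volume ≤ C * eLpNorm (classicalGrad φ) 2 volume := by
  have h1 : ENNReal.HolderConjugate 1 ⊤ := inferInstance
  simpa using exists_eLpNorm_le_mul_eLpNorm_classicalGrad hn hb h1
    (ENNReal.div_lt_top (ENNReal.natCast_ne_top n) two_ne_zero)

theorem tendsto_enorm_sub_of_tendsto {E : Type*} [NormedAddCommGroup E] {a : ℕ → E} {b : E}
    (h : Tendsto a atTop (𝓝 b)) :
    Tendsto (fun p : ℕ × ℕ => ‖a p.1 - a p.2‖ₑ) atTop (𝓝 0) := by
  rw [← prod_atTop_atTop_eq]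
  have := (h.comp tendsto_fst).sub (h.comp (tendsto_snd (f := (atTop : Filter ℕ))))
  simpa [Function.comp_def] using (continuous_enorm.tendsto _).comp this

/-- **Rellich's theorem** for test functions: a sequence of test functions on a bounded set whose
gradients are bounded in `L²` has a subsequence that is Cauchy in `L²`. -/
theorem exists_subseq_cauchy_eLpNorm_two (hn : 1 ≤ n) (hb : Bornology.IsBounded D)
    {φ : ℕ → EuclideanSpace ℝ (Fin n) → ℂ} (hφ : ∀ k, IsTestFunction D (φ k))
    (h1 : ∀ k, eLpNorm (classicalGrad (φ k)) 2 volume ≤ 1) :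
    ∃ ns : ℕ → ℕ, StrictMono ns ∧
      Tendsto (fun p : ℕ × ℕ => eLpNorm (φ (ns p.1) - φ (ns p.2)) 2 volume) atTop (𝓝 0) := by
  obtain ⟨C, hC, hF⟩ := exists_lintegral_sq_le_gridCube (D := D) hn
  obtain ⟨C₁, hC₁, hP⟩ := exists_eLpNorm_two_le hn hb
  obtain ⟨C₂, hC₂, hL⟩ := eLpNorm_mono_exponent_of_isBounded (E := ℂ) hb
    (one_le_two : (1 : ℝ≥0∞) ≤ 2)
  set R : ℝ := (C₂ * C₁).toReal
  have hint : ∀ k, Integrable (φ k) volume := fun k => memLp_one_iff_integrable.1 ((hφ k).memLp 1)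
  have hbound : ∀ k (s : Set (EuclideanSpace ℝ (Fin n))), ‖∫ x in s, φ k x‖ ≤ R := by
    intro k s
    have e : ‖∫ x in s, φ k x‖ₑ ≤ C₂ * C₁ := by
      calc ‖∫ x in s, φ k x‖ₑ ≤ ∫⁻ x in s, ‖φ k x‖ₑ := enorm_integral_le_lintegral_enorm _
        _ ≤ eLpNorm (φ k) 1 volume := by
            rw [eLpNorm_one_eq_lintegral_enorm]; exact setLIntegral_le_lintegral _ _
        _ ≤ C₂ * eLpNorm (φ k) 2 volume := by
            have := hL _ (hφ k).continuous.aestronglyMeasurable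
            rwa [(hφ k).eLpNorm_restrict, (hφ k).eLpNorm_restrict] at this
        _ ≤ C₂ * C₁ := by
            gcongr
            refine (hP _ (hφ k)).trans ?_
            calc _ ≤ C₁ * 1 := by gcongr; exact h1 k
              _ = C₁ := mul_one _
    rw [← toReal_enorm]
    exact ENNReal.toReal_mono (ENNReal.mul_ne_top hC₂ hC₁) e
  -- All integrals over all cubes at the scales `1/(j+1)` form one point of a countable product of
  -- closed discs. Its sequential compactness gives a single subsequence along which all of them
  -- converge, in place of a diagonal argument.
  let a : ℕ → (ℕ × (Fin n → ℤ)) → ℂ := fun k jc =>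
    ∫ x in gridCube (1 / ((jc.1 : ℝ) + 1)) jc.2, φ k x
  obtain ⟨b, -, ns, hns, hlim⟩ := (isCompact_univ_pi fun _ : ℕ × (Fin n → ℤ) =>
    isCompact_closedBall (0 : ℂ) R).tendsto_subseq (x := a)
    (fun k jc _ => mem_closedBall_zero_iff.2 (hbound k _))
  rw [tendsto_pi_nhds] at hlim
  refine ⟨ns, hns, ?_⟩
  have hdiff : ∀ p : ℕ × ℕ, IsTestFunction D (φ (ns p.1) - φ (ns p.2)) :=
    fun p => (hφ _).sub (hφ _)
  have hgrad : ∀ p : ℕ × ℕ,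
      ∫⁻ x, ‖classicalGrad (φ (ns p.1) - φ (ns p.2)) x‖ₑ ^ 2 ≤ 4 := by
    intro p
    rw [← eLpNorm_two_sq, (hφ _).classicalGrad_sub (hφ _)]
    have : eLpNorm (classicalGrad (φ (ns p.1)) - classicalGrad (φ (ns p.2))) 2 volume ≤ 2 := by
      refine (eLpNorm_sub_le ((hφ _).memLp_classicalGrad 2).1 ((hφ _).memLp_classicalGrad 2).1
        one_le_two).trans ((add_le_add (h1 _) (h1 _)).trans ?_)
      norm_num
    calc _ ≤ (2 : ℝ≥0∞) ^ 2 := by gcongr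
      _ = 4 := by norm_num
  have hsq : Tendsto (fun p : ℕ × ℕ => eLpNorm (φ (ns p.1) - φ (ns p.2)) 2 volume ^ 2)
      atTop (𝓝 0) := by
    rw [ENNReal.tendsto_nhds_zero]
    intro ε hε
    have hsmall : Tendsto (fun j : ℕ => C * ENNReal.ofReal (1 / ((j : ℝ) + 1)) ^ 2 * 4)
        atTop (𝓝 0) := by
      have t : Tendsto (fun j : ℕ => ENNReal.ofReal (1 / ((j : ℝ) + 1)) ^ 2) atTop (𝓝 0) := by
        have := ((ENNReal.continuous_ofReal.tendsto 0).comp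
          tendsto_one_div_add_atTop_nhds_zero_nat)
        simpa using ENNReal.Tendsto.pow (n := 2) this
      simpa using ENNReal.Tendsto.mul_const
        (ENNReal.Tendsto.const_mul t (Or.inr hC)) (Or.inr (by simp : (4 : ℝ≥0∞) ≠ ⊤))
    -- The scale is fixed first, so that the gradient term is at most `ε / 2`; only then are the
    -- finitely many cube integrals made small.
    have hε2 : 0 < ε / 2 := ENNReal.half_pos hε.ne'
    obtain ⟨j, hj⟩ := ((ENNReal.tendsto_nhds_zero.1 hsmall) _ hε2).exists
    set h : ℝ := 1 / ((j : ℝ) + 1)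
    have hh : 0 < h := by positivity
    have hfin := finite_gridCube_inter hb hh
    have hzero : ∀ p : ℕ × ℕ, ∀ c ∉ hfin.toFinset,
        ‖∫ x in gridCube h c, (φ (ns p.1) - φ (ns p.2)) x‖ₑ ^ 2 = 0 := by
      intro p c hc
      rw [setIntegral_eq_zero_of_forall_eq_zero]
      · simp
      · intro x hx
        by_contra h0
        exact hc (hfin.mem_toFinset.2 ⟨x, hx, (hdiff p).support_subset h0⟩)
    have hlimsum : Tendsto (fun p : ℕ × ℕ => (ENNReal.ofReal h ^ n)⁻¹ *
        (2 * ∑ c ∈ hfin.toFinset, ‖∫ x in gridCube h c, (φ (ns p.1) - φ (ns p.2)) x‖ₑ ^ 2))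
        atTop (𝓝 0) := by
      have t : Tendsto (fun p : ℕ × ℕ => ∑ c ∈ hfin.toFinset,
          ‖∫ x in gridCube h c, (φ (ns p.1) - φ (ns p.2)) x‖ₑ ^ 2) atTop (𝓝 0) := by
        rw [← Finset.sum_const_zero (s := hfin.toFinset)]
        refine tendsto_finsetSum _ fun c _ => ?_
        have := ENNReal.Tendsto.pow (n := 2) (tendsto_enorm_sub_of_tendsto (hlim (j, c)))
        rw [zero_pow two_ne_zero] at this
        refine this.congr fun p => ?_
        simp only [Function.comp_apply, Pi.sub_apply, a]
        rw [integral_sub (hint _).restrict (hint _).restrict]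
      have h0 : (ENNReal.ofReal h ^ n)⁻¹ ≠ ⊤ :=
        ENNReal.inv_ne_top.2 (pow_ne_zero _ (by simpa using hh))
      simpa using ENNReal.Tendsto.const_mul
        (ENNReal.Tendsto.const_mul t (Or.inr (by simp : (2 : ℝ≥0∞) ≠ ⊤))) (Or.inr h0)
    filter_upwards [(ENNReal.tendsto_nhds_zero.1 hlimsum) _ hε2] with p hp
    rw [eLpNorm_two_sq, ← ENNReal.add_halves ε]
    refine (hF h hh _ (hdiff p)).trans ?_
    rw [tsum_eq_sum (hzero p)]
    refine add_le_add (le_trans ?_ hj) hp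
    gcongr
    exact hgrad p
  have := (ENNReal.continuous_rpow_const (y := (1 / 2 : ℝ))).tendsto 0 |>.comp hsq
  simp only [Function.comp_def, ← ENNReal.rpow_natCast, ← ENNReal.rpow_mul] at this
  simpa using this

end Rellich

/-! ### Interpolation between `L²` and `L^s`. -/

section Interpolation

variable {α ι : Type*} [MeasurableSpace α] {μ : Measure α} {l : Filter ι}

/-- Convergence to zero in `L²` and boundedness in `L^s` give convergence to zero in `L^p` for
`2 ≤ p < s`. -/
theorem tendsto_eLpNorm_of_tendsto_two_of_bounded {w : ι → α → ℂ}
    (hw : ∀ i, AEStronglyMeasurable (w i) μ) {p s B : ℝ≥0∞} (hB : B ≠ ⊤) (hs : s ≠ ⊤)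
    (h2p : 2 ≤ p) (hps : p < s) (hb : ∀ i, eLpNorm (w i) s μ ≤ B)
    (h2 : Tendsto (fun i => eLpNorm (w i) 2 μ) l (𝓝 0)) :
    Tendsto (fun i => eLpNorm (w i) p μ) l (𝓝 0) := by
  have hpt : p ≠ ⊤ := hps.ne_top
  have hp0 : p ≠ 0 := (two_pos.trans_le h2p).ne'
  have hs0 : s ≠ 0 := (bot_le.trans_lt hps).ne'
  set P := p.toReal with hP
  set S := s.toReal with hS
  have hP2 : 2 ≤ P := by simpa using ENNReal.toReal_mono hpt h2p
  have hPS : P < S := (ENNReal.toReal_lt_toReal hpt hs).2 hps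
  -- The weights solve `a + b = 1`, `2a + Sb = P`, so Hölder applies to `|w|^P = (|w|²)^a
  -- (|w|^S)^b`. Strictness of `p < s` gives `a > 0`, without which the `L²` factor would not tend
  -- to zero.
  set a : ℝ := (S - P) / (S - 2) with ha
  set b : ℝ := (P - 2) / (S - 2) with hb'
  have hS2 : 0 < S - 2 := by linarith
  have ha0 : 0 < a := div_pos (by linarith) hS2
  have hb0 : 0 ≤ b := div_nonneg (by linarith) hS2.le
  have hab : a + b = 1 := by rw [ha, hb', ← add_div, div_eq_one_iff_eq hS2.ne']; ring
  have habP : 2 * a + S * b = P := by rw [ha, hb']; field_simp; ring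
  have hbound : ∀ i, eLpNorm (w i) p μ ≤
      ((eLpNorm (w i) 2 μ ^ (2 : ℝ)) ^ a * (B ^ S) ^ b) ^ (1 / P) := by
    intro i
    have e2 : eLpNorm (w i) 2 μ ^ (2 : ℝ) = ∫⁻ x, ‖w i x‖ₑ ^ (2 : ℝ) ∂μ := by
      have := eLpNorm_two_sq (μ := μ) (w i)
      simpa using this
    have eS : ∫⁻ x, ‖w i x‖ₑ ^ S ∂μ ≤ B ^ S := by
      have h0 : 0 < S := by linarith
      have := hb i
      rw [eLpNorm_eq_lintegral_rpow_enorm_toReal hs0 hs, one_div,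
        ENNReal.rpow_inv_le_iff h0] at this
      exact this
    rw [eLpNorm_eq_lintegral_rpow_enorm_toReal hp0 hpt, e2]
    refine ENNReal.rpow_le_rpow ?_ (by positivity)
    calc ∫⁻ x, ‖w i x‖ₑ ^ P ∂μ
        = ∫⁻ x, (‖w i x‖ₑ ^ (2 : ℝ)) ^ a * (‖w i x‖ₑ ^ S) ^ b ∂μ := by
          refine lintegral_congr fun x => ?_
          rw [← ENNReal.rpow_mul, ← ENNReal.rpow_mul, ← ENNReal.rpow_add_of_nonneg _ _
            (by positivity) (mul_nonneg (by linarith) hb0), habP]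
      _ ≤ (∫⁻ x, ‖w i x‖ₑ ^ (2 : ℝ) ∂μ) ^ a * (∫⁻ x, ‖w i x‖ₑ ^ S ∂μ) ^ b :=
          ENNReal.lintegral_mul_norm_pow_le ((hw i).enorm.pow_const _) ((hw i).enorm.pow_const _)
            ha0.le hb0 hab
      _ ≤ _ := by gcongr
  have hBt : (B ^ S) ^ b ≠ ⊤ := by
    refine ENNReal.rpow_ne_top_of_nonneg hb0 (ENNReal.rpow_ne_top_of_nonneg (by linarith) hB)
  have hc : Tendsto (fun i => ((eLpNorm (w i) 2 μ ^ (2 : ℝ)) ^ a * (B ^ S) ^ b) ^ (1 / P))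
      l (𝓝 0) := by
    have t1 := ((ENNReal.continuous_rpow_const (y := (2 : ℝ))).tendsto 0).comp h2
    have t2 := ((ENNReal.continuous_rpow_const (y := a)).tendsto _).comp t1
    have t3 := ENNReal.Tendsto.mul_const t2 (Or.inr hBt)
    have t4 := ((ENNReal.continuous_rpow_const (y := 1 / P)).tendsto _).comp t3
    have hP0 : 0 < P := by linarith
    simpa [Function.comp_def, ENNReal.zero_rpow_of_pos, ha0, hP0] using t4
  exact tendsto_of_tendsto_of_tendsto_of_le_of_le tendsto_const_nhds hc (fun _ => bot_le) hbound

end Interpolation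

/-! ### Strong convergence of maximizing sequences. -/

section MaximizingSequence

/-- If a maximizing sequence for the quotient of two norms converges in the norm of the numerator,
then it is Cauchy in the Hilbert norm of the denominator. -/
theorem cauchySeq_of_maximizing {X H : Type*} [NormedAddCommGroup X] [NormedSpace ℝ X]
    [NormedAddCommGroup H] [InnerProductSpace ℂ H] {F : ℕ → X} {G : ℕ → H} {κ : ℝ} (hκ : 0 < κ)
    (hG : ∀ k, ‖G k‖ = 1) (hFG : ∀ j k, ‖F j + F k‖ ≤ κ * ‖G j + G k‖)
    (hF : Tendsto (fun k => ‖F k‖) atTop (𝓝 κ))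
    (hd : Tendsto (fun p : ℕ × ℕ => ‖F p.1 - F p.2‖) atTop (𝓝 0)) : CauchySeq G := by
  have hfst : Tendsto (Prod.fst : ℕ × ℕ → ℕ) atTop atTop := by
    rw [← prod_atTop_atTop_eq]; exact tendsto_fst
  have hs : Tendsto (fun p : ℕ × ℕ => ‖G p.1 + G p.2‖) atTop (𝓝 2) := by
    -- The triangle inequality for `2 F_j = (F_j + F_k) + (F_j - F_k)` bounds `‖F_j + F_k‖` below by
    -- a quantity tending to `2κ`.
    have hlow : Tendsto (fun p : ℕ × ℕ => (2 * ‖F p.1‖ - ‖F p.1 - F p.2‖) / κ) atTop (𝓝 2) := by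
      have := (((hF.comp hfst).const_mul 2).sub hd).div_const κ
      rw [sub_zero, mul_div_assoc, div_self hκ.ne', mul_one] at this
      exact this
    refine tendsto_of_tendsto_of_tendsto_of_le_of_le hlow tendsto_const_nhds ?_ ?_
    · intro p
      dsimp only
      rw [div_le_iff₀' hκ]
      refine le_trans ?_ (hFG _ _)
      have e : (2 : ℝ) • F p.1 = (F p.1 + F p.2) + (F p.1 - F p.2) := by rw [two_smul]; abel
      have h2 : ‖(2 : ℝ) • F p.1‖ = 2 * ‖F p.1‖ := by rw [norm_smul]; norm_num
      have := norm_add_le (F p.1 + F p.2) (F p.1 - F p.2)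
      rw [← e, h2] at this
      linarith
    · intro p
      refine (norm_add_le _ _).trans (le_of_eq ?_)
      rw [hG, hG]
      norm_num
  rw [cauchySeq_iff_tendsto_dist_atTop_0]
  -- For unit vectors the parallelogram law reads `‖G_j - G_k‖² = 4 - ‖G_j + G_k‖²`.
  have hsq : Tendsto (fun p : ℕ × ℕ => √(4 - ‖G p.1 + G p.2‖ ^ 2)) atTop (𝓝 0) := by
    have := (Real.continuous_sqrt.tendsto _).comp ((hs.pow 2).const_sub 4)
    norm_num at this
    exact this
  refine hsq.congr fun p => ?_
  have := parallelogram_law_with_norm ℂ (G p.1) (G p.2)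
  rw [hG, hG] at this
  rw [dist_eq_norm, ← Real.sqrt_sq (norm_nonneg (G p.1 - G p.2))]
  congr 1
  linarith

end MaximizingSequence

/-! ### Existence of extremals. -/

section Extremal

variable {n : ℕ} {D : Set (EuclideanSpace ℝ (Fin n))}

/-- Since `r > max (n/2) 1` strictly, `r` can be lowered a little; this raises the conjugate
exponent and keeps it finite. That room is the source of compactness. -/
theorem exists_larger_exponent {q r : ℝ≥0∞} (hqr : ENNReal.HolderConjugate q r)
    (hr : (n : ℝ≥0∞) / 2 < r) (hr1 : 1 < r) :
    ∃ q' r' : ℝ≥0∞, ENNReal.HolderConjugate q' r' ∧ (n : ℝ≥0∞) / 2 < r' ∧ q < q' ∧ q' ≠ ⊤ := by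
  obtain ⟨r', h1, h2⟩ := exists_between (max_lt hr hr1)
  rw [max_lt_iff] at h1
  have hc : ENNReal.HolderConjugate r'.conjExponent r' :=
    (ENNReal.HolderConjugate.conjExponent h1.2.le).symm
  have e1 : q⁻¹ + r⁻¹ = 1 := hqr.inv_add_inv_eq_one
  have e2 : r'.conjExponent⁻¹ + r'⁻¹ = 1 := hc.inv_add_inv_eq_one
  have hri : r⁻¹ < r'⁻¹ := ENNReal.inv_lt_inv.2 h2
  have hr'1 : r'⁻¹ < 1 := ENNReal.inv_lt_one.2 h1.2
  refine ⟨_, r', hc, h1.1, ?_, ?_⟩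
  · rw [← ENNReal.inv_lt_inv]
    by_contra! hle
    have hlt : q⁻¹ + r⁻¹ < r'.conjExponent⁻¹ + r'⁻¹ :=
      ENNReal.add_lt_add_of_le_of_lt (fun h => by rw [h] at e1; simp at e1) hle hri
    rw [e1, e2] at hlt
    exact lt_irrefl _ hlt
  · intro h
    rw [h, ENNReal.inv_top, zero_add] at e2
    exact hr'1.ne e2

/-- Compactness of the subcritical Sobolev embedding, for sequences of test functions. -/
theorem exists_subseq_cauchy_eLpNorm (hn : 1 ≤ n) (hb : Bornology.IsBounded D)
    {q r : ℝ≥0∞} (hqr : ENNReal.HolderConjugate q r) (hr : (n : ℝ≥0∞) / 2 < r) (hr1 : 1 < r)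
    {φ : ℕ → EuclideanSpace ℝ (Fin n) → ℂ} (hφ : ∀ k, IsTestFunction D (φ k))
    (h1 : ∀ k, eLpNorm (classicalGrad (φ k)) 2 volume ≤ 1) :
    ∃ ns : ℕ → ℕ, StrictMono ns ∧
      Tendsto (fun p : ℕ × ℕ => eLpNorm (φ (ns p.1) - φ (ns p.2)) (2 * q) volume)
        atTop (𝓝 0) := by
  obtain ⟨ns, hns, h2⟩ := exists_subseq_cauchy_eLpNorm_two hn hb hφ h1
  obtain ⟨q', r', hqr', hr', hqq', hq't⟩ := exists_larger_exponent hqr hr hr1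
  obtain ⟨C, hC, hS⟩ := exists_eLpNorm_le_mul_eLpNorm_classicalGrad hn hb hqr' hr'
  have hq1 : 1 ≤ q := ENNReal.HolderConjugate.one_le q r
  refine ⟨ns, hns, tendsto_eLpNorm_of_tendsto_two_of_bounded
    (fun p => ((hφ _).sub (hφ _)).continuous.aestronglyMeasurable) (s := 2 * q') (B := C * 2)
    (ENNReal.mul_ne_top hC (by simp)) (ENNReal.mul_ne_top (by simp) hq't)
    ?_ ?_ (fun p => ?_) h2⟩
  · calc (2 : ℝ≥0∞) = 2 * 1 := (mul_one _).symm
      _ ≤ 2 * q := by gcongr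
  · exact (ENNReal.mul_lt_mul_iff_right (by simp) (by simp)).2 hqq'
  · refine (hS _ ((hφ _).sub (hφ _))).trans ?_
    gcongr
    rw [(hφ _).classicalGrad_sub (hφ _)]
    refine (eLpNorm_sub_le ((hφ _).memLp_classicalGrad 2).1 ((hφ _).memLp_classicalGrad 2).1
      one_le_two).trans ((add_le_add (h1 _) (h1 _)).trans ?_)
    norm_num

/-- A bump function at a point of `D` would have zero `L^{2q}` norm. -/
theorem sobolevConst_ne_zero (hn : 1 ≤ n) (hD : IsOpen D) (hb : Bornology.IsBounded D)
    (hne : D.Nonempty) {q : ℝ≥0∞} (hq : q ≠ 0) : sobolevConst D q ≠ 0 := by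
  intro h0
  obtain ⟨x, hx⟩ := hne
  obtain ⟨η, h1, h2, h3, -, h5⟩ :=
    exists_contDiff_tsupport_subset (n := (⊤ : ℕ∞)) (hD.mem_nhds hx)
  have hη := isTestFunction_ofReal h3 h2 h1
  have h6 := hη.eLpNorm_le_sobolevConst hn hD hb (q := q)
  rw [h0, zero_mul, nonpos_iff_eq_zero, eLpNorm_eq_zero_iff hη.continuous.aestronglyMeasurable
    (mul_ne_zero two_ne_zero hq)] at h6
  have h7 := congrFun (hη.continuous.ae_eq_iff_eq _ continuous_zero |>.1 h6) x
  rw [h5] at h7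
  exact one_ne_zero (Complex.ofReal_injective h7)

/-- By `sobolevConst_le` a bound valid on test functions bounds `K`, so test functions already
approach the supremum; scaling then normalizes the gradient. -/
theorem exists_test_lt_eLpNorm (hn : 1 ≤ n) (hD : IsOpen D) (hb : Bornology.IsBounded D)
    {q c : ℝ≥0∞} (hc : c < sobolevConst D q) :
    ∃ φ, IsTestFunction D φ ∧ eLpNorm (classicalGrad φ) 2 volume = 1 ∧
      c < eLpNorm φ (2 * q) volume := by
  have h := mt (sobolevConst_le (D := D) (q := q) hc.ne_top) (not_le.2 hc)
  push Not at h
  obtain ⟨φ, hφ, hlt⟩ := h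
  set G := eLpNorm (classicalGrad φ) 2 volume with hG
  have hGt : G ≠ ⊤ := (hφ.memLp_classicalGrad 2).eLpNorm_ne_top
  -- If `G = 0`, the Sobolev bound for `φ` is `K * 0 = 0`, against the strict inequality `hlt`.
  have hG0 : G ≠ 0 := by
    intro h0
    have := hφ.eLpNorm_le_sobolevConst hn hD hb (q := q)
    rw [← hG, h0, mul_zero] at this
    rw [h0, mul_zero] at hlt
    exact absurd hlt (not_lt.2 this)
  have he : ‖((G.toReal⁻¹ : ℝ) : ℂ)‖ₑ = G⁻¹ := by
    rw [← ofReal_norm, Complex.norm_real, Real.norm_of_nonneg (by positivity),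
      ← ENNReal.toReal_inv, ENNReal.ofReal_toReal (ENNReal.inv_ne_top.2 hG0)]
  refine ⟨((G.toReal⁻¹ : ℝ) : ℂ) • φ, hφ.const_smul _, ?_, ?_⟩
  · rw [hφ.classicalGrad_const_smul, eLpNorm_const_smul, he, ← hG, ENNReal.inv_mul_cancel hG0 hGt]
  · rw [eLpNorm_const_smul, he, mul_comm, ← div_eq_mul_inv,
      ENNReal.lt_div_iff_mul_lt (Or.inl hG0) (Or.inl hGt)]
    exact hlt

theorem exists_isSobolevExtremal (hn : 1 ≤ n) (hD : IsOpen D) (hb : Bornology.IsBounded D)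
    (hne : D.Nonempty) {q r : ℝ≥0∞} (hqr : ENNReal.HolderConjugate q r)
    (hr : (n : ℝ≥0∞) / 2 < r) (hr1 : 1 < r) : ∃ u, IsSobolevExtremal D q u := by
  have hq0 : q ≠ 0 := ENNReal.HolderConjugate.ne_zero q r
  have hq1 : 1 ≤ q := ENNReal.HolderConjugate.one_le q r
  have h2q : 1 ≤ 2 * q := by
    calc (1 : ℝ≥0∞) = 1 * 1 := (mul_one _).symm
      _ ≤ 2 * q := by gcongr; exact one_le_two
  have : Fact (1 ≤ 2 * q) := ⟨h2q⟩
  set K := sobolevConst D q with hK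
  have hKt : K ≠ ⊤ := sobolevConst_ne_top hn hb hqr hr
  have hK0 : K ≠ 0 := sobolevConst_ne_zero hn hD hb hne hq0
  obtain ⟨c, -, hcK, hclim⟩ := exists_seq_strictMono_tendsto' (pos_iff_ne_zero.2 hK0)
  choose φ₀ hφ₀ hφ₀g hφ₀c using fun k => exists_test_lt_eLpNorm hn hD hb (hcK k).2
  obtain ⟨ns, hns, hcau⟩ :=
    exists_subseq_cauchy_eLpNorm hn hb hqr hr hr1 hφ₀ fun k => (hφ₀g k).le
  set φ := fun k => φ₀ (ns k)
  have hφ : ∀ k, IsTestFunction D (φ k) := fun k => hφ₀ _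
  have hφg : ∀ k, eLpNorm (classicalGrad (φ k)) 2 volume = 1 := fun k => hφ₀g _
  have hφlim : Tendsto (fun k => eLpNorm (φ k) (2 * q) volume) atTop (𝓝 K) := by
    refine tendsto_of_tendsto_of_tendsto_of_le_of_le (hclim.comp hns.tendsto_atTop)
      tendsto_const_nhds (fun k => (hφ₀c _).le) fun k => ?_
    have := (hφ k).eLpNorm_le_sobolevConst hn hD hb (q := q)
    rwa [hφg, mul_one] at this
  set ν := volume.restrict D
  let F : ℕ → Lp ℂ (2 * q) ν := fun k => (((hφ k).memLp _).restrict D).toLp (φ k)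
  let H : ℕ → Lp ℂ 2 ν := fun k => (((hφ k).memLp _).restrict D).toLp (φ k)
  let G : ℕ → Lp (EuclideanSpace ℂ (Fin n)) 2 ν := fun k =>
    (((hφ k).memLp_classicalGrad _).restrict D).toLp (classicalGrad (φ k))
  have hGn : ∀ k, ‖G k‖ = 1 := by
    intro k
    rw [Lp.norm_toLp, (hφ k).eLpNorm_classicalGrad_restrict, hφg, ENNReal.toReal_one]
  have hGc : CauchySeq G := by
    refine cauchySeq_of_maximizing (F := F) (κ := K.toReal) (ENNReal.toReal_pos hK0 hKt) hGn
      ?_ ?_ ?_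
    · intro j k
      have e1 : F j + F k =
          ((((hφ j).add (hφ k)).memLp _).restrict D).toLp (φ j + φ k) := rfl
      have e2 : G j + G k =
          (((hφ j).add (hφ k)).memLp_classicalGrad 2 |>.restrict D).toLp
            (classicalGrad (φ j + φ k)) := by
        simp only [(hφ j).classicalGrad_add (hφ k)]
        rfl
      rw [e1, e2, Lp.norm_toLp, Lp.norm_toLp, ((hφ j).add (hφ k)).eLpNorm_restrict,
        ((hφ j).add (hφ k)).eLpNorm_classicalGrad_restrict, ← ENNReal.toReal_mul]
      exact ENNReal.toReal_mono (ENNReal.mul_ne_top hKt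
        (((hφ j).add (hφ k)).memLp_classicalGrad 2).eLpNorm_ne_top)
        (((hφ j).add (hφ k)).eLpNorm_le_sobolevConst hn hD hb)
    · refine ((ENNReal.tendsto_toReal hKt).comp hφlim).congr fun k => ?_
      rw [Lp.norm_toLp, (hφ k).eLpNorm_restrict, Function.comp_apply]
    · refine ((ENNReal.tendsto_toReal ENNReal.zero_ne_top).comp hcau).congr fun p => ?_
      have e1 : F p.1 - F p.2 =
          ((((hφ p.1).sub (hφ p.2)).memLp _).restrict D).toLp (φ p.1 - φ p.2) := rfl
      rw [e1, Lp.norm_toLp, ((hφ p.1).sub (hφ p.2)).eLpNorm_restrict, Function.comp_apply]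
  -- Poincaré's inequality carries the Cauchy property from the gradients to the functions in `L²`,
  -- the space in which membership of the limit in `W₀^{1,2}` is decided.
  have hHc : CauchySeq H := by
    obtain ⟨C, hC, hP⟩ := exists_eLpNorm_two_le hn hb
    rw [cauchySeq_iff_tendsto_dist_atTop_0] at hGc ⊢
    have hlim := hGc.const_mul C.toReal
    rw [mul_zero] at hlim
    refine tendsto_of_tendsto_of_tendsto_of_le_of_le tendsto_const_nhds hlim
      (fun _ => dist_nonneg) fun p => ?_
    have e1 : H p.1 - H p.2 =
        ((((hφ p.1).sub (hφ p.2)).memLp _).restrict D).toLp (φ p.1 - φ p.2) := rfl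
    have e2 : G p.1 - G p.2 =
        (((hφ p.1).sub (hφ p.2)).memLp_classicalGrad 2 |>.restrict D).toLp
          (classicalGrad (φ p.1 - φ p.2)) := by
      simp only [(hφ p.1).classicalGrad_sub (hφ p.2)]
      rfl
    dsimp only
    rw [dist_eq_norm, dist_eq_norm, e1, e2, Lp.norm_toLp, Lp.norm_toLp,
      ((hφ p.1).sub (hφ p.2)).eLpNorm_restrict,
      ((hφ p.1).sub (hφ p.2)).eLpNorm_classicalGrad_restrict, ← ENNReal.toReal_mul]
    exact ENNReal.toReal_mono (ENNReal.mul_ne_top hC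
      (((hφ p.1).sub (hφ p.2)).memLp_classicalGrad 2).eLpNorm_ne_top)
      (hP _ ((hφ p.1).sub (hφ p.2)))
  obtain ⟨g, hg⟩ := cauchySeq_tendsto_of_complete hGc
  obtain ⟨u, hu⟩ := cauchySeq_tendsto_of_complete hHc
  rw [Lp.tendsto_Lp_iff_tendsto_eLpNorm'] at hg hu
  have hg' : Tendsto (fun k => eLpNorm (classicalGrad (φ k) - ⇑g) 2 ν) atTop (𝓝 0) := by
    refine hg.congr fun k => eLpNorm_congr_ae ?_
    exact ((((hφ k).memLp_classicalGrad _).restrict D).coeFn_toLp).sub EventuallyEq.rfl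
  have hu' : Tendsto (fun k => eLpNorm (φ k - ⇑u) 2 ν) atTop (𝓝 0) := by
    refine hu.congr fun k => eLpNorm_congr_ae ?_
    exact ((((hφ k).memLp _).restrict D).coeFn_toLp).sub EventuallyEq.rfl
  obtain ⟨hW, hae⟩ := memW012_of_tendsto hD hb hφ (Lp.memLp u) (Lp.memLp g) hu' hg'
  have hgrad : eLpNorm (weakGrad D u) 2 ν = 1 := by
    rw [eLpNorm_congr_ae hae]
    refine tendsto_nhds_unique (tendsto_eLpNorm_of_tendsto_sub one_le_two
      (fun k => ((hφ k).memLp_classicalGrad _).restrict D) (Lp.memLp g) hg') ?_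
    refine tendsto_const_nhds.congr fun k => ?_
    rw [(hφ k).eLpNorm_classicalGrad_restrict, hφg]
  -- Gradient convergence implies convergence to `u` in `L^{2q}`, so the norms converge to that of
  -- `u`; they also converge to `K`.
  have hval : eLpNorm u (2 * q) ν = K := by
    have hg'' : Tendsto (fun k => eLpNorm (classicalGrad (φ k) - weakGrad D u) 2 ν)
        atTop (𝓝 0) :=
      hg'.congr fun k => eLpNorm_congr_ae (EventuallyEq.rfl.sub hae.symm)
    have t := hW.tendsto_eLpNorm_sub hn hD hb hKt hφ hg''
    refine tendsto_nhds_unique (tendsto_eLpNorm_of_tendsto_sub h2q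
      (fun k => ((hφ k).memLp _).restrict D) (hW.memLp hn hb hKt) t) ?_
    exact hφlim.congr fun k => ((hφ k).eLpNorm_restrict _).symm
  refine ⟨u, hW, fun h0 => hK0 ?_, ?_⟩
  · rw [← hval, eLpNorm_congr_ae h0, eLpNorm_zero]
  · rw [hgrad, hval, div_one]

end Extremal

/-! ### Potentials in `L^r` and their quadratic forms. -/

section Potential

variable {α : Type*} [MeasurableSpace α] {μ : Measure α} {q r : ℝ≥0∞}

theorem memLp_conj {p : ℝ≥0∞} {f : α → ℂ} (hf : MemLp f p μ) :
    MemLp (fun x => (starRingEnd ℂ) (f x)) p μ :=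
  hf.of_le (Complex.continuous_conj.comp_aestronglyMeasurable hf.1)
    (Eventually.of_forall fun x => by simp)

theorem tendsto_eLpNorm_conj {p : ℝ≥0∞} {F : ℕ → α → ℂ} {f : α → ℂ}
    (h : Tendsto (fun k => eLpNorm (F k - f) p μ) atTop (𝓝 0)) :
    Tendsto (fun k => eLpNorm ((fun x => (starRingEnd ℂ) (F k x)) -
      fun x => (starRingEnd ℂ) (f x)) p μ) atTop (𝓝 0) := by
  refine h.congr fun k => eLpNorm_congr_norm_ae (Eventually.of_forall fun x => ?_)
  simp only [Pi.sub_apply, ← map_sub, RCLike.norm_conj]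

/-- A potential in `L^r` maps `L^{2q}` to its dual space. -/
theorem exists_holderConjugate_memLp_mul (hqr : ENNReal.HolderConjugate q r) {V : α → ℝ}
    (hV : MemLp V r μ) {u : α → ℂ} (hu : MemLp u (2 * q) μ) :
    ∃ s : ℝ≥0∞, ENNReal.HolderConjugate (2 * q) s ∧ MemLp (fun x => (V x : ℂ) * u x) s μ := by
  -- With `1/s = 1/r + 1/(2q)`, the sum `1/(2q) + 1/s` equals `1/q + 1/r = 1`.
  refine ⟨(r⁻¹ + (2 * q)⁻¹)⁻¹, ?_, ?_⟩
  · rw [ENNReal.holderConjugate_iff, inv_inv, ENNReal.mul_inv (by simp) (by simp),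
      ← hqr.inv_add_inv_eq_one, add_left_comm, ← add_mul, ENNReal.inv_two_add_inv_two, one_mul,
      add_comm]
  · have := ENNReal.HolderTriple.of r (2 * q)
    exact hu.mul (f := u) (φ := fun x => (V x : ℂ)) hV.ofReal

theorem integrable_potential_mul (hqr : ENNReal.HolderConjugate q r) {V : α → ℝ}
    (hV : MemLp V r μ) {u w : α → ℂ} (hu : MemLp u (2 * q) μ) (hw : MemLp w (2 * q) μ) :
    Integrable (fun x => (V x : ℂ) * u x * w x) μ := by
  obtain ⟨s, hs, hVu⟩ := exists_holderConjugate_memLp_mul hqr hV hu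
  have := hs.symm
  exact integrable_mul_of_holderConjugate hVu hw

theorem integrable_potential_mul_inner (hqr : ENNReal.HolderConjugate q r) {V : α → ℝ}
    (hV : MemLp V r μ) {u w : α → ℂ} (hu : MemLp u (2 * q) μ) (hw : MemLp w (2 * q) μ) :
    Integrable (fun x => V x * (inner ℂ (u x) (w x)).re) μ := by
  refine (integrable_potential_mul hqr hV (memLp_conj hu) hw).re.congr
    (Eventually.of_forall fun x => ?_)
  simp only [RCLike.inner_apply, mul_assoc, RCLike.re_to_complex, Complex.re_ofReal_mul]
  rw [mul_comm (w x)]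

theorem integrable_potential_mul_norm_sq (hqr : ENNReal.HolderConjugate q r) {V : α → ℝ}
    (hV : MemLp V r μ) {u : α → ℂ} (hu : MemLp u (2 * q) μ) :
    Integrable (fun x => V x * ‖u x‖ ^ 2) μ := by
  refine (integrable_potential_mul_inner hqr hV hu hu).congr (Eventually.of_forall fun x => ?_)
  simp only
  rw [inner_self_eq_norm_sq_to_K]
  norm_cast

/-- Hölder for `V ∈ L^r` and `|u|² ∈ L^q`, with `‖|u|²‖_q = ‖u‖_{2q}²`. -/
theorem lintegral_potential_mul_sq_le (hqr : ENNReal.HolderConjugate q r) {V : α → ℝ}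
    (hV : AEStronglyMeasurable V μ) {u : α → ℂ} (hu : AEStronglyMeasurable u μ) :
    ∫⁻ x, ‖V x * ‖u x‖ ^ 2‖ₑ ∂μ ≤ eLpNorm V r μ * eLpNorm u (2 * q) μ ^ 2 := by
  have := hqr.symm
  have h1 := eLpNorm_smul_le_mul_eLpNorm (p := r) (q := q) (r := 1) (φ := V)
    (f := fun x => ‖u x‖ ^ (2 : ℝ)) (hu.norm.aemeasurable.pow_const (2 : ℝ)).aestronglyMeasurable hV
  rw [eLpNorm_norm_rpow u two_pos, eLpNorm_one_eq_lintegral_enorm] at h1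
  simpa [mul_comm q] using h1

/-- Expansion of a weighted quadratic integral along a line. -/
theorem integral_mul_norm_add_smul_sq {E : Type*} [NormedAddCommGroup E] [InnerProductSpace ℂ E]
    {V : α → ℝ} {f b : α → E} (h1 : Integrable (fun x => V x * ‖f x‖ ^ 2) μ)
    (h2 : Integrable (fun x => V x * (inner ℂ (f x) (b x)).re) μ)
    (h3 : Integrable (fun x => V x * ‖b x‖ ^ 2) μ) (t : ℝ) :
    ∫ x, V x * ‖f x + (t : ℂ) • b x‖ ^ 2 ∂μ = (∫ x, V x * ‖f x‖ ^ 2 ∂μ) +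
      2 * t * (∫ x, V x * (inner ℂ (f x) (b x)).re ∂μ) + t ^ 2 * ∫ x, V x * ‖b x‖ ^ 2 ∂μ := by
  have h12 : Integrable
      (fun x => V x * ‖f x‖ ^ 2 + 2 * t * (V x * (inner ℂ (f x) (b x)).re)) μ :=
    h1.add (h2.const_mul _)
  rw [← integral_const_mul, ← integral_const_mul, ← integral_add h1 (h2.const_mul _),
    ← integral_add h12 (h3.const_mul _)]
  refine integral_congr_ae (Eventually.of_forall fun x => ?_)
  simp only
  rw [norm_add_sq (𝕜 := ℂ), inner_smul_right, norm_smul, Complex.norm_real, mul_pow,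
    Real.norm_eq_abs, sq_abs]
  simp only [RCLike.re_to_complex, Complex.re_ofReal_mul]
  ring

/-- The two parabolas touch at `t = 0` without crossing, so their slopes there agree. -/
theorem eq_of_forall_quadratic_le {a b b' c c' : ℝ}
    (h : ∀ t : ℝ, a + 2 * t * b + t ^ 2 * c ≤ a + 2 * t * b' + t ^ 2 * c') : b = b' := by
  by_contra hne
  have hd : 0 < (b - b') ^ 2 := by have := sub_ne_zero.2 hne; positivity
  set M := |c' - c| + 1 with hM
  have hM0 : 0 < M := by positivity
  have hcM : c' - c ≤ M := by have := le_abs_self (c' - c); linarith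
  -- At this `t` the linear terms differ by `2(b - b')²/M`, while the quadratic ones can compensate
  -- at most `(b - b')²/M`.
  have := h ((b - b') / M)
  have h2 : ((b - b') / M) ^ 2 * (c' - c) ≤ ((b - b') / M) ^ 2 * M := by gcongr
  have h3 : ((b - b') / M) ^ 2 * M = (b - b') ^ 2 / M := by field_simp
  have h4 : 2 * ((b - b') / M) * (b - b') = 2 * ((b - b') ^ 2 / M) := by ring
  have h5 : 0 < (b - b') ^ 2 / M := by positivity
  nlinarith

end Potential

/-! ### The energy identity and the lower bound for the potential. -/

section Inequality

variable {n : ℕ} {D : Set (EuclideanSpace ℝ (Fin n))} {q r : ℝ≥0∞}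
  {V : EuclideanSpace ℝ (Fin n) → ℝ} {u : EuclideanSpace ℝ (Fin n) → ℂ}

theorem ofReal_integral_norm_sq {E α : Type*} [MeasurableSpace α] {μ : Measure α}
    [NormedAddCommGroup E] {g : α → E} (hg : MemLp g 2 μ) :
    ENNReal.ofReal (∫ x, ‖g x‖ ^ 2 ∂μ) = eLpNorm g 2 μ ^ 2 := by
  rw [eLpNorm_two_sq, ofReal_integral_eq_lintegral_ofReal
    ((memLp_two_iff_integrable_sq_norm hg.1).1 hg) (Eventually.of_forall fun x => by positivity)]
  refine lintegral_congr fun x => ?_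
  rw [ENNReal.ofReal_pow (norm_nonneg _), ofReal_norm]

/-- The energy identity of a solution, obtained by testing the equation with the solution. -/
theorem IsDistribSolution.integral_norm_weakGrad_sq (hn : 1 ≤ n) (hD : IsOpen D)
    (hb : Bornology.IsBounded D) (hqr : ENNReal.HolderConjugate q r)
    (hK : sobolevConst D q ≠ ⊤) (hV : MemLp V r (volume.restrict D)) (hu : MemW012 D u)
    (hs : IsDistribSolution D V u) :
    ∫ x in D, ‖weakGrad D u x‖ ^ 2 = ∫ x in D, V x * ‖u x‖ ^ 2 := by
  obtain ⟨φ, hφ, t1, t2⟩ := hu.2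
  have hg := hu.1.memLp_weakGrad
  have hu2 := hu.memLp hn hb hK
  obtain ⟨s, hqs, hVu⟩ := exists_holderConjugate_memLp_mul hqr hV hu2
  have tR := tendsto_integral_mul (fun k => memLp_conj (((hφ k).memLp (2 * q)).restrict D))
    (memLp_conj hu2) hVu (tendsto_eLpNorm_conj (hu.tendsto_eLpNorm_sub hn hD hb hK hφ t2))
  have hgi := fun i => memLp_euclidean_apply hg i
  have hφi := fun k i => memLp_euclidean_apply (((hφ k).memLp_classicalGrad 2).restrict D) i
  have tL := tendsto_finsetSum Finset.univ fun i (_ : i ∈ Finset.univ) =>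
    tendsto_integral_mul (fun k => memLp_conj (hφi k i)) (memLp_conj (hgi i)) (hgi i)
      (tendsto_eLpNorm_conj (tendsto_eLpNorm_apply t2 i))
  have heq : ∀ k, ∑ i, ∫ x in D, (starRingEnd ℂ) (classicalGrad (φ k) x i) * weakGrad D u x i =
      ∫ x in D, (starRingEnd ℂ) (φ k x) * ((V x : ℂ) * u x) := by
    intro k
    -- The weak form is bilinear, so conjugated test functions are needed to obtain `|∇u|²` and
    -- `V|u|²` in the limit.
    have := (hs _ (hφ k).conj).2
    rw [← integral_finsetSum _ fun i _ =>
      integrable_mul_of_holderConjugate (memLp_conj (hφi k i)) (hgi i)]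
    simp_rw [(hφ k).classicalGrad_conj, mul_comm (weakGrad D u _ _)] at this
    rw [this]
    exact integral_congr_ae (Eventually.of_forall fun x => mul_comm _ _)
  simp_rw [heq] at tL
  have key := tendsto_nhds_unique tL tR
  rw [← integral_finsetSum _ fun i _ =>
    integrable_mul_of_holderConjugate (memLp_conj (hgi i)) (hgi i)] at key
  have e1 : ∀ x, ∑ i, (starRingEnd ℂ) (weakGrad D u x i) * weakGrad D u x i =
      ((‖weakGrad D u x‖ ^ 2 : ℝ) : ℂ) := by
    intro x
    rw [EuclideanSpace.norm_sq_eq]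
    push_cast
    exact Finset.sum_congr rfl fun i _ => Complex.conj_mul' _
  have e2 : ∀ x, (starRingEnd ℂ) (u x) * ((V x : ℂ) * u x) = ((V x * ‖u x‖ ^ 2 : ℝ) : ℂ) := by
    intro x
    rw [mul_left_comm, Complex.conj_mul']
    push_cast
    rfl
  simp_rw [e1, e2, integral_complex_ofReal] at key
  exact_mod_cast key

theorem IsDistribSolution.one_le_sobolevConst_sq_mul (hn : 1 ≤ n) (hD : IsOpen D)
    (hb : Bornology.IsBounded D) (hqr : ENNReal.HolderConjugate q r)
    (hK : sobolevConst D q ≠ ⊤) (hV : MemLp V r (volume.restrict D)) (hu : MemW012 D u)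
    (h0 : IsNontrivialOn D u) (hs : IsDistribSolution D V u) :
    1 ≤ sobolevConst D q ^ 2 * eLpNorm (fun x => max (V x) 0) r (volume.restrict D) := by
  set ν := volume.restrict D
  set G := eLpNorm (weakGrad D u) 2 ν with hG
  have hG0 : G ≠ 0 := hu.eLpNorm_weakGrad_ne_zero hn hb h0
  have hGt : G ≠ ⊤ := hu.1.memLp_weakGrad.eLpNorm_ne_top
  have hu2 := hu.memLp hn hb hK
  have hVp : MemLp (fun x => max (V x) 0) r ν := hV.pos_part
  have hle : G ^ 2 ≤ sobolevConst D q ^ 2 * eLpNorm (fun x => max (V x) 0) r ν * G ^ 2 := by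
    calc G ^ 2 = ENNReal.ofReal (∫ x, V x * ‖u x‖ ^ 2 ∂ν) := by
          rw [← hs.integral_norm_weakGrad_sq hn hD hb hqr hK hV hu,
            ofReal_integral_norm_sq hu.1.memLp_weakGrad]
      _ ≤ ENNReal.ofReal (∫ x, max (V x) 0 * ‖u x‖ ^ 2 ∂ν) := by
          refine ENNReal.ofReal_le_ofReal (integral_mono
            (integrable_potential_mul_norm_sq hqr hV hu2)
            (integrable_potential_mul_norm_sq hqr hVp hu2) fun x => ?_)
          dsimp only
          gcongr
          exact le_max_left _ _
      _ = ∫⁻ x, ‖max (V x) 0 * ‖u x‖ ^ 2‖ₑ ∂ν := by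
          rw [ofReal_integral_eq_lintegral_ofReal (integrable_potential_mul_norm_sq hqr hVp hu2)
            (Eventually.of_forall fun x => by positivity)]
          refine lintegral_congr fun x => ?_
          rw [Real.enorm_of_nonneg (by positivity)]
      _ ≤ eLpNorm (fun x => max (V x) 0) r ν * eLpNorm u (2 * q) ν ^ 2 :=
          lintegral_potential_mul_sq_le hqr hVp.1 hu2.1
      _ ≤ eLpNorm (fun x => max (V x) 0) r ν * (sobolevConst D q * G) ^ 2 := by
          gcongr
          exact hu.eLpNorm_le_sobolevConst hn hb
      _ = _ := by ring
  by_contra! hlt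
  have := (ENNReal.mul_lt_mul_iff_left (pow_ne_zero 2 hG0) (ENNReal.pow_ne_top hGt)).2 hlt
  rw [one_mul] at this
  exact absurd hle (not_le.2 this)

end Inequality

/-! ### The Euler–Lagrange equation and equality for extremals. -/

section Extremal

variable {n : ℕ} {D : Set (EuclideanSpace ℝ (Fin n))} {q r : ℝ≥0∞}
  {V : EuclideanSpace ℝ (Fin n) → ℝ} {u : EuclideanSpace ℝ (Fin n) → ℂ}

/-- Hölder, then Sobolev: the constants combine to `K²‖V‖_r ≤ 1`. It says that the form `∫|∇v|² -
∫V|v|²` is nonnegative on `W₀^{1,2}`. -/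
theorem integral_potential_mul_sq_le (hn : 1 ≤ n)
    (hb : Bornology.IsBounded D) (hqr : ENNReal.HolderConjugate q r)
    (hK : sobolevConst D q ≠ ⊤) (hV : MemLp V r (volume.restrict D)) (hV0 : ∀ x, 0 ≤ V x)
    (hV1 : sobolevConst D q ^ 2 * eLpNorm V r (volume.restrict D) ≤ 1) (hu : MemW012 D u) :
    ∫ x in D, V x * ‖u x‖ ^ 2 ≤ ∫ x in D, ‖weakGrad D u x‖ ^ 2 := by
  set ν := volume.restrict D
  have hu2 := hu.memLp hn hb hK
  rw [← ENNReal.ofReal_le_ofReal_iff (integral_nonneg fun x => by positivity),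
    ofReal_integral_norm_sq hu.1.memLp_weakGrad,
    ofReal_integral_eq_lintegral_ofReal (integrable_potential_mul_norm_sq hqr hV hu2)
      (Eventually.of_forall fun x => mul_nonneg (hV0 x) (by positivity))]
  calc ∫⁻ x, ENNReal.ofReal (V x * ‖u x‖ ^ 2) ∂ν = ∫⁻ x, ‖V x * ‖u x‖ ^ 2‖ₑ ∂ν :=
        lintegral_congr fun x => by
          rw [Real.enorm_of_nonneg (mul_nonneg (hV0 x) (by positivity))]
    _ ≤ eLpNorm V r ν * eLpNorm u (2 * q) ν ^ 2 := lintegral_potential_mul_sq_le hqr hV.1 hu2.1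
    _ ≤ eLpNorm V r ν * (sobolevConst D q * eLpNorm (weakGrad D u) 2 ν) ^ 2 := by
        gcongr
        exact hu.eLpNorm_le_sobolevConst hn hb
    _ = sobolevConst D q ^ 2 * eLpNorm V r ν * eLpNorm (weakGrad D u) 2 ν ^ 2 := by ring
    _ ≤ 1 * eLpNorm (weakGrad D u) 2 ν ^ 2 := by gcongr
    _ = _ := one_mul _

theorem integrable_inner {E α : Type*} [MeasurableSpace α] {μ : Measure α}
    [NormedAddCommGroup E] [InnerProductSpace ℂ E] {f g : α → E} (hf : MemLp f 2 μ)
    (hg : MemLp g 2 μ) : Integrable (fun x => (inner ℂ (f x) (g x)).re) μ := by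
  refine (hf.norm.integrable_mul hg.norm).mono' ?_ (Eventually.of_forall fun x => ?_)
  · exact Complex.continuous_re.comp_aestronglyMeasurable (hf.1.inner hg.1)
  · exact (Complex.abs_re_le_norm _).trans (norm_inner_le_norm _ _)

/-- If a nonnegative potential has norm at most `K_q(D)⁻²`, then equality in the resulting form
inequality forces the Euler-Lagrange equation. -/
theorem isDistribSolution_of_integral_eq (hn : 1 ≤ n) (hD : IsOpen D)
    (hb : Bornology.IsBounded D) (hqr : ENNReal.HolderConjugate q r)
    (hK : sobolevConst D q ≠ ⊤) (hV : MemLp V r (volume.restrict D)) (hV0 : ∀ x, 0 ≤ V x)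
    (hV1 : sobolevConst D q ^ 2 * eLpNorm V r (volume.restrict D) ≤ 1) (hu : MemW012 D u)
    (heq : ∫ x in D, V x * ‖u x‖ ^ 2 = ∫ x in D, ‖weakGrad D u x‖ ^ 2) :
    IsDistribSolution D V u := by
  have hu2 := hu.memLp hn hb hK
  have hg := hu.1.memLp_weakGrad
  have hint : ∀ ψ, IsTestFunction D ψ →
      Integrable (fun x => (V x : ℂ) * u x * ψ x) (volume.restrict D) := fun ψ hψ =>
    integrable_potential_mul hqr hV hu2 ((hψ.memLp _).restrict D)
  have hintL : ∀ ψ, IsTestFunction D ψ →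
      Integrable (fun x => ∑ i, weakGrad D u x i * classicalGrad ψ x i) (volume.restrict D) :=
    fun ψ hψ => integrable_finsetSum _ fun i _ =>
      integrable_mul_of_holderConjugate (p := 2) (q := 2) (memLp_euclidean_apply hg i)
        (memLp_euclidean_apply ((hψ.memLp_classicalGrad 2).restrict D) i)
  have hre : ∀ ψ, IsTestFunction D ψ →
      (∫ x in D, ∑ i, weakGrad D u x i * classicalGrad ψ x i).re =
        (∫ x in D, (V x : ℂ) * u x * ψ x).re := by
    intro ψ hψ
    have hχ := hψ.conj
    -- The variation is in the direction of the conjugate of `ψ`, which turns the sesquilinear first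
    -- variation into the real part of the bilinear weak form.
    set χ := fun x => (starRingEnd ℂ) (ψ x) with hχdef
    have hχ2 := (hχ.memLp (2 * q)).restrict D
    have hχg := (hχ.memLp_classicalGrad 2).restrict D
    -- Both forms at `u + tχ` are quadratic in `t`, ordered for all `t`, and equal at `t = 0` by
    -- `heq`; hence the linear coefficients agree.
    have hquad := eq_of_forall_quadratic_le
      (a := ∫ x in D, V x * ‖u x‖ ^ 2)
      (b := ∫ x in D, V x * (inner ℂ (u x) (χ x)).re)
      (b' := ∫ x in D, 1 * (inner ℂ (weakGrad D u x) (classicalGrad χ x)).re)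
      (c := ∫ x in D, V x * ‖χ x‖ ^ 2)
      (c' := ∫ x in D, 1 * ‖classicalGrad χ x‖ ^ 2) fun t => by
        obtain ⟨hm, hae⟩ := hu.add_test hD hb (hχ.const_smul (t : ℂ))
        have h1 := integral_potential_mul_sq_le hn hb hqr hK hV hV0 hV1 hm
        have e1 := integral_mul_norm_add_smul_sq
          (integrable_potential_mul_norm_sq hqr hV hu2)
          (integrable_potential_mul_inner hqr hV hu2 hχ2)
          (integrable_potential_mul_norm_sq hqr hV hχ2) t
        have e2 := integral_mul_norm_add_smul_sq (V := fun _ => (1 : ℝ))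
          (f := weakGrad D u) (b := classicalGrad χ) (μ := volume.restrict D)
          (by simpa using (memLp_two_iff_integrable_sq_norm hg.1).1 hg)
          (by simpa using integrable_inner hg hχg)
          (by simpa using (memLp_two_iff_integrable_sq_norm hχg.1).1 hχg) t
        have e3 : ∫ x in D, ‖weakGrad D (u + (t : ℂ) • χ) x‖ ^ 2 =
            ∫ x in D, 1 * ‖weakGrad D u x + (t : ℂ) • classicalGrad χ x‖ ^ 2 := by
          refine integral_congr_ae ?_
          filter_upwards [hae] with x hx
          rw [hx, hχ.classicalGrad_const_smul, one_mul]
          rfl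
        have e4 : ∫ x in D, 1 * ‖weakGrad D u x‖ ^ 2 = ∫ x in D, V x * ‖u x‖ ^ 2 := by
          simp_rw [one_mul, heq]
        rw [e3, e2, e4] at h1
        exact e1.symm.le.trans h1
    rw [← RCLike.re_to_complex, ← RCLike.re_to_complex, ← integral_re (hintL ψ hψ),
      ← integral_re (hint ψ hψ)]
    refine Eq.trans ?_ (hquad.symm.trans ?_)
    · refine integral_congr_ae (Eventually.of_forall fun x => ?_)
      simp only
      rw [one_mul, ← RCLike.re_to_complex, ← inner_re_symm, PiLp.inner_apply]
      congr 1
      refine Finset.sum_congr rfl fun i _ => ?_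
      rw [RCLike.inner_apply, hψ.classicalGrad_conj, Complex.conj_conj]
    · refine integral_congr_ae (Eventually.of_forall fun x => ?_)
      simp only
      rw [← RCLike.re_to_complex, ← inner_re_symm, RCLike.inner_apply, hχdef, Complex.conj_conj,
        mul_assoc]
      simp only [RCLike.re_to_complex, Complex.re_ofReal_mul]
  intro ψ hψ
  refine ⟨hint ψ hψ, Complex.ext (hre ψ hψ) ?_⟩
  -- Replacing `ψ` by `iψ` turns the identity of real parts into that of imaginary parts.
  have h := hre _ (hψ.const_smul Complex.I)
  have l1 : ∫ x in D, ∑ i, weakGrad D u x i * classicalGrad (Complex.I • ψ) x i =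
      Complex.I * ∫ x in D, ∑ i, weakGrad D u x i * classicalGrad ψ x i := by
    rw [← integral_const_mul]
    refine integral_congr_ae (Eventually.of_forall fun x => ?_)
    simp only [hψ.classicalGrad_const_smul, Pi.smul_apply, PiLp.smul_apply, smul_eq_mul,
      Finset.mul_sum]
    exact Finset.sum_congr rfl fun i _ => by ring
  have l2 : ∫ x in D, (V x : ℂ) * u x * (Complex.I • ψ) x =
      Complex.I * ∫ x in D, (V x : ℂ) * u x * ψ x := by
    rw [← integral_const_mul]
    refine integral_congr_ae (Eventually.of_forall fun x => ?_)
    simp only [Pi.smul_apply, smul_eq_mul]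
    ring
  rw [l1, l2, Complex.I_mul_re, Complex.I_mul_re] at h
  exact neg_injective h

theorem extremalPotential_nonneg (D : Set (EuclideanSpace ℝ (Fin n))) (q : ℝ≥0∞)
    (u : EuclideanSpace ℝ (Fin n) → ℂ) (x : EuclideanSpace ℝ (Fin n)) :
    0 ≤ extremalPotential D q u x := by
  unfold extremalPotential
  positivity

/-- Conjugacy gives `r(2q - 2) = 2q`. For `q = 1`, `r = ∞` the function is the constant `1`, whose
essential supremum is `1` only if `μ ≠ 0`. -/
theorem eLpNorm_norm_rpow_of_holderConjugate {α : Type*} [MeasurableSpace α] {μ : Measure α}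
    (hqr : ENNReal.HolderConjugate q r) (hq : q ≠ ⊤) {f : α → ℂ} (hμ : μ ≠ 0) :
    eLpNorm (fun x => ‖f x‖ ^ (2 * q.toReal - 2)) r μ =
      eLpNorm f (2 * q) μ ^ (2 * q.toReal - 2) := by
  by_cases hq1 : q = 1
  · have hr : r = ⊤ := (ENNReal.HolderConjugate.eq_top_iff_eq_one r q).2 hq1
    have : (2 : ℝ) * q.toReal - 2 = 0 := by simp [hq1]
    simp only [this, Real.rpow_zero, ENNReal.rpow_zero, hr]
    rw [eLpNorm_const _ (by simp) hμ]
    simp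
  · have hlt : 1 < q := lt_of_le_of_ne (ENNReal.HolderConjugate.one_le q r) (Ne.symm hq1)
    have hQ : 1 < q.toReal := by simpa using (ENNReal.toReal_lt_toReal (by simp) hq).2 hlt
    have hr : r ≠ ⊤ := (ENNReal.HolderConjugate.ne_top_iff_ne_one r q).2 hq1
    have hr0 : 0 < r.toReal := ENNReal.toReal_pos (ENNReal.HolderConjugate.ne_zero r q) hr
    rw [eLpNorm_norm_rpow f (by linarith)]
    have hsum : q.toReal⁻¹ + r.toReal⁻¹ = 1 := by
      rw [← ENNReal.toReal_inv, ← ENNReal.toReal_inv, ← ENNReal.toReal_add,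
        hqr.inv_add_inv_eq_one, ENNReal.toReal_one]
      · exact ENNReal.inv_ne_top.2 (ENNReal.HolderConjugate.ne_zero q r)
      · exact ENNReal.inv_ne_top.2 (ENNReal.HolderConjugate.ne_zero r q)
    have hexp : r * ENNReal.ofReal (2 * q.toReal - 2) = 2 * q := by
      rw [← ENNReal.toReal_eq_toReal_iff' (ENNReal.mul_ne_top hr (by simp))
        (ENNReal.mul_ne_top (by simp) hq), ENNReal.toReal_mul, ENNReal.toReal_mul,
        ENNReal.toReal_ofReal (by linarith)]
      have hq0 : q.toReal ≠ 0 := by linarith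
      field_simp at hsum
      simp only [ENNReal.toReal_ofNat]
      linarith
    rw [hexp]

namespace IsSobolevExtremal

theorem eLpNorm_ne_zero (hu : IsSobolevExtremal D q u) (hq : q ≠ 0) :
    eLpNorm u (2 * q) (volume.restrict D) ≠ 0 := by
  rw [Ne, eLpNorm_eq_zero_iff hu.mem.1.1.1 (mul_ne_zero two_ne_zero hq)]
  exact hu.nontrivial

/-- With `G = ‖∇u‖₂` and `N = ‖u‖_{2q}` this is `(N/G)² · G² N^{-2q} · N^{2q-2} = 1`. -/
theorem sobolevConst_sq_mul_eLpNorm (hn : 1 ≤ n) (hb : Bornology.IsBounded D)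
    (hqr : ENNReal.HolderConjugate q r) (hq : q ≠ ⊤) (hK : sobolevConst D q ≠ ⊤)
    (hu : IsSobolevExtremal D q u) :
    sobolevConst D q ^ 2 * eLpNorm (extremalPotential D q u) r (volume.restrict D) = 1 := by
  set ν := volume.restrict D with hν
  have hν0 : ν ≠ 0 := fun h => hu.nontrivial (by
    rw [← hν, h, ae_zero]
    exact eventually_bot)
  have hq0 : q ≠ 0 := ENNReal.HolderConjugate.ne_zero q r
  have hG0 := hu.mem.eLpNorm_weakGrad_ne_zero hn hb hu.nontrivial
  have hGt := hu.mem.1.memLp_weakGrad.eLpNorm_ne_top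
  have hN0 := hu.eLpNorm_ne_zero hq0
  have hNt := (hu.mem.memLp hn hb hK).eLpNorm_ne_top
  have hform : extremalPotential D q u = ((eLpNorm (weakGrad D u) 2 ν).toReal ^ 2 /
      (eLpNorm u (2 * q) ν).toReal ^ (2 * q.toReal)) •
        fun x => ‖u x‖ ^ (2 * q.toReal - 2) := rfl
  rw [hform, eLpNorm_const_smul, eLpNorm_norm_rpow_of_holderConjugate hqr hq hν0, hu.eq]
  set G := eLpNorm (weakGrad D u) 2 ν
  set N := eLpNorm u (2 * q) ν
  have hG : 0 < G.toReal := ENNReal.toReal_pos hG0 hGt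
  have hN : 0 < N.toReal := ENNReal.toReal_pos hN0 hNt
  rw [← ENNReal.toReal_eq_one_iff, ENNReal.toReal_mul, ENNReal.toReal_mul, ENNReal.toReal_pow,
    ENNReal.toReal_div, toReal_enorm, ← ENNReal.toReal_rpow,
    Real.norm_of_nonneg (by positivity), Real.rpow_sub hN, Real.rpow_two]
  have hN' : N.toReal ^ (2 * q.toReal) ≠ 0 := by positivity
  field_simp

/-- The product of the norm with the nonzero `K²` is `1`, so the norm is finite. -/
theorem memLp_extremalPotential (hn : 1 ≤ n) (hb : Bornology.IsBounded D)
    (hqr : ENNReal.HolderConjugate q r) (hq : q ≠ ⊤) (hK : sobolevConst D q ≠ ⊤)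
    (hu : IsSobolevExtremal D q u) :
    MemLp (extremalPotential D q u) r (volume.restrict D) := by
  have h := hu.sobolevConst_sq_mul_eLpNorm hn hb hqr hq hK
  have hK0 : sobolevConst D q ^ 2 ≠ 0 := fun h0 => by
    rw [h0, zero_mul] at h
    exact zero_ne_one h
  refine ⟨?_, lt_top_iff_ne_top.2 fun ht => ?_⟩
  · exact ((hu.mem.1.1.1.norm.aemeasurable.pow_const _).const_mul _).aestronglyMeasurable
  · rw [ht, ENNReal.mul_top hK0] at h
    exact ENNReal.top_ne_one h

/-- The integrand is `G² N^{-2q} |u|^{2q}`, and `∫|u|^{2q} = N^{2q}`: the form vanishes at the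
extremal. -/
theorem integral_potential_mul_sq (hn : 1 ≤ n) (hb : Bornology.IsBounded D)
    (hq0 : q ≠ 0) (hq : q ≠ ⊤) (hK : sobolevConst D q ≠ ⊤) (hu : IsSobolevExtremal D q u) :
    ∫ x in D, extremalPotential D q u x * ‖u x‖ ^ 2 = ∫ x in D, ‖weakGrad D u x‖ ^ 2 := by
  have hL := hu.mem.memLp hn hb hK
  have hN0 := hu.eLpNorm_ne_zero hq0
  have hQ : 0 < q.toReal := ENNReal.toReal_pos hq0 hq
  set G := (eLpNorm (weakGrad D u) 2 (volume.restrict D)).toReal with hG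
  set N := (eLpNorm u (2 * q) (volume.restrict D)).toReal with hN
  have hNpos : 0 < N := ENNReal.toReal_pos hN0 hL.eLpNorm_ne_top
  have e1 : ∀ x, extremalPotential D q u x * ‖u x‖ ^ 2 =
      G ^ 2 / N ^ (2 * q.toReal) * ‖u x‖ ^ (2 * q.toReal) := by
    intro x
    have : ‖u x‖ ^ (2 * q.toReal) = ‖u x‖ ^ (2 * q.toReal - 2) * ‖u x‖ ^ (2 : ℝ) := by
      rw [← Real.rpow_add' (norm_nonneg _) (by linarith)]
      congr 1
      ring
    rw [this, Real.rpow_two, ← mul_assoc]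
    rfl
  have e2 : ∫ x in D, ‖u x‖ ^ (2 * q.toReal) = N ^ (2 * q.toReal) := by
    have h1 := hL.eLpNorm_eq_integral_rpow_norm (mul_ne_zero two_ne_zero hq0)
      (ENNReal.mul_ne_top (by simp) hq)
    simp only [ENNReal.toReal_mul, ENNReal.toReal_ofNat] at h1
    have h0 : 0 ≤ ∫ x in D, ‖u x‖ ^ (2 * q.toReal) := integral_nonneg fun x => by positivity
    rw [hN, h1, ENNReal.toReal_ofReal (by positivity), Real.rpow_inv_rpow h0 (by positivity)]
  have e3 : ∫ x in D, ‖weakGrad D u x‖ ^ 2 = G ^ 2 := by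
    rw [hG, ← ENNReal.toReal_pow, ← ofReal_integral_norm_sq hu.mem.1.memLp_weakGrad,
      ENNReal.toReal_ofReal (integral_nonneg fun x => by positivity)]
  simp_rw [e1]
  rw [integral_const_mul, e2, e3, div_mul_cancel₀ _ (by positivity)]

end IsSobolevExtremal

end Extremal

theorem theorem1p1 {n : ℕ} (hn : 1 ≤ n) (D : Set (EuclideanSpace ℝ (Fin n)))
    (hD_open : IsOpen D) (hD_bdd : Bornology.IsBounded D) (hD_ne : D.Nonempty)
    (q r : ℝ≥0∞) (hqr : ENNReal.HolderConjugate q r) (hr : (n : ℝ≥0∞) / 2 < r) :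
    -- the Sobolev constant is finite
    sobolevConst D q ≠ (⊤ : ℝ≥0∞) ∧
    -- the inequality
    (∀ (V : EuclideanSpace ℝ (Fin n) → ℝ) (u : EuclideanSpace ℝ (Fin n) → ℂ),
      MemLp V r (volume.restrict D) → MemW012 D u → IsNontrivialOn D u →
      IsDistribSolution D V u →
      1 ≤ sobolevConst D q ^ 2 * eLpNorm (fun x => max (V x) 0) r (volume.restrict D)) ∧
    -- extremals exist, and each of them gives a solution with equality
    (1 < r →
      (∃ u : EuclideanSpace ℝ (Fin n) → ℂ, IsSobolevExtremal D q u) ∧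
      ∀ u : EuclideanSpace ℝ (Fin n) → ℂ, IsSobolevExtremal D q u →
        MemLp (extremalPotential D q u) r (volume.restrict D) ∧
        IsDistribSolution D (extremalPotential D q u) u ∧
        sobolevConst D q ^ 2 *
          eLpNorm (fun x => max (extremalPotential D q u x) 0) r (volume.restrict D) = 1) := by
  have hK := sobolevConst_ne_top hn hD_bdd hqr hr
  refine ⟨hK, fun V u hV hu h0 hs =>
    hs.one_le_sobolevConst_sq_mul hn hD_open hD_bdd hqr hK hV hu h0, fun hr1 => ?_⟩
  have hq : q ≠ ⊤ := (ENNReal.HolderConjugate.ne_top_iff_ne_one q r).2 hr1.ne'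
  refine ⟨exists_isSobolevExtremal hn hD_open hD_bdd hD_ne hqr hr hr1, fun u hu => ?_⟩
  have hV := hu.memLp_extremalPotential hn hD_bdd hqr hq hK
  have hnorm := hu.sobolevConst_sq_mul_eLpNorm hn hD_bdd hqr hq hK
  have hV0 := extremalPotential_nonneg D q u
  refine ⟨hV, ?_, ?_⟩
  · exact isDistribSolution_of_integral_eq hn hD_open hD_bdd hqr hK hV hV0 hnorm.le hu.mem
      (hu.integral_potential_mul_sq hn hD_bdd (ENNReal.HolderConjugate.ne_zero q r) hq hK)
  · simpa only [max_eq_left (hV0 _)] using hnorm
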